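/- Let $(\mathcal X,\nu)$ be a $\sigma$-finite measure space (write $dx$ for $\nu(dx)$) and let $\phi:\mathcal X^2\to\mathbb R$ be a measurable Mercer kernel, i.e. all finite Gram matrices $(\phi(x^{(i)},x^{(j)}))_{i,j}$ are symmetric positive semidefinite, such that $\int_{\mathcal X}e^{-c\,\phi(x,x)}\,dx<\infty$ for every $c>0$. Put $f(x)=-\phi(x,x)$. For a symmetric array $\theta=(\theta_{st})_{1\le s\ne t\le p}$ let $$\mathbb P(x;\theta)=\exp\Big\{\sum_{s=1}^p f(x_s)+\sum_{s<t}\theta_{st}\,\phi(x_s,x_t)-A(\theta)\Big\},\qquad A(\theta)=\log\int_{\mathcal X^p}\exp\Big\{\sum_{s} f(x_s)+\sum_{s<t}\theta_{st}\,\phi(x_s,x_t)\Big\}dx ,$$ a probability density whenever $A(\theta)<\infty$. Let $\theta^*$ be such that $A(\theta)<\infty$ for all $\theta$ in a neighbourhood of $\theta^*$, that $|\theta^*_{st}|<0.25$ for all $s\ne t$, and that $\mathbb P(\cdot;\theta^*)$ has minimal representation: no $\theta\neq\theta^*$ with $A(\theta)<\infty$ defines the same distribution. Let $X^{(1)},\dots,X^{(n)}$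 be i.i.d. from $\mathbb P(\cdot;\theta^*)$. Fix a node $s$, write $\theta_s=(\theta_{st})_{t\ne s}\in\mathbb R^{p-1}$, let $$\tilde L(\theta_s)=\frac1n\sum_{i=1}^n\Big\{-f(X_s^{(i)})-\sum_{t\ne s}\theta_{st}\phi(X^{(i)}_s,X^{(i)}_t)+\log\int_{\mathcal X}\exp\Big(f(u)+\sum_{t\neq s}\theta_{st}\phi(u,X^{(i)}_t)\Big)du\Big\}$$ be the negative conditional log-likelihood of $X_s$ given the other variables, let $\tilde\gamma_n=\|\nabla\tilde L(\theta^*_s)\|_\infty$, and let $\hat\theta^n_s$ denote a minimizer of $\tilde L(\theta_s)+\lambda_n\|\theta_s\|_1$ over $\theta_s\in\mathbb R^{p-1}$. Then for every $\kappa>0$ there is a constant $C>0$, not depending on $n$ (it may depend on the model $(\nu,\phi,p,\theta^*)$, on $s$ and on $\kappa$), such that for every $c_0\ge2$ there is an $N$ such that for all $n\ge N$, with probability at least $1-p^{-\kappa}$: for every $\lambda_n\in[2\tilde\gamma_n,\,c_0\tilde\gamma_n]$ a minimizer $\hat\theta^n_s$ exists, and every minimizer satisfies $$\|\hat\theta^n_s-\theta^*_s\|\le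 C\,c_0\sqrt{\frac{\|\theta^*_s\|_0\,\ln p}{n}} ,$$ where $\|\cdot\|$ is the Euclidean norm and $\|\cdot\|_0$ counts the nonzero entries. -/

import Mathlib

open MeasureTheory Filter Topology

noncomputable section

namespace SemiEFGM

/-- A Mercer kernel: every finite Gram matrix is (symmetric and) positive semidefinite. -/
def IsMercerKernel {𝒳 : Type*} (φ : 𝒳 → 𝒳 → ℝ) : Prop :=
  ∀ (m : ℕ) (x : Fin m → 𝒳), (Matrix.of fun i j => φ (x i) (x j)).PosSemidef

/-- The exponent `∑ₛ f(xₛ) + ∑_{s<t} θₛₜ φ(xₛ, xₜ)`: all node parameters are `1`, and each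
unordered pair of nodes contributes once (non-edges have `θₛₜ = 0`). -/
def exponent {𝒳 : Type*} {p : ℕ} (f : 𝒳 → ℝ) (φ : 𝒳 → 𝒳 → ℝ) (θ : Fin p → Fin p → ℝ)
    (x : Fin p → 𝒳) : ℝ :=
  ∑ s, f (x s) + ∑ s, ∑ t ∈ Finset.Ioi s, θ s t * φ (x s) (x t)

/-- The condition `A(θ) < ∞`. -/
def Normalizable {𝒳 : Type*} [MeasurableSpace 𝒳] (ν : Measure 𝒳) {p : ℕ} (f : 𝒳 → ℝ)
    (φ : 𝒳 → 𝒳 → ℝ) (θ : Fin p → Fin p → ℝ) : Prop :=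
  Integrable (fun x : Fin p → 𝒳 => Real.exp (exponent f φ θ x)) (Measure.pi fun _ => ν)

/-- The log-partition function `A(θ)`. -/
def logPartition {𝒳 : Type*} [MeasurableSpace 𝒳] (ν : Measure 𝒳) {p : ℕ} (f : 𝒳 → ℝ)
    (φ : 𝒳 → 𝒳 → ℝ) (θ : Fin p → Fin p → ℝ) : ℝ :=
  Real.log (∫ x : Fin p → 𝒳, Real.exp (exponent f φ θ x) ∂(Measure.pi fun _ => ν))

/-- The joint law of `X = (X₁, …, X_p)`, with density `exp(exponent - A(θ))` with respect to
the `p`-fold product of the reference measure `ν` on `𝒳`. -/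
def jointLaw {𝒳 : Type*} [MeasurableSpace 𝒳] (ν : Measure 𝒳) {p : ℕ} (f : 𝒳 → ℝ)
    (φ : 𝒳 → 𝒳 → ℝ) (θ : Fin p → Fin p → ℝ) : Measure (Fin p → 𝒳) :=
  (Measure.pi fun _ => ν).withDensity fun x =>
    ENNReal.ofReal (Real.exp (exponent f φ θ x - logPartition ν f φ θ))

/-- Minimal representation: no other pairwise parameter vector yields the same joint law. -/
def HasMinimalRepresentation {𝒳 : Type*} [MeasurableSpace 𝒳] (ν : Measure 𝒳) {p : ℕ}
    (f : 𝒳 → ℝ) (φ : 𝒳 → 𝒳 → ℝ) (θ : Fin p → Fin p → ℝ) : Prop :=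
  ∀ θ' : Fin p → Fin p → ℝ, Normalizable ν f φ θ' →
    jointLaw ν f φ θ' = jointLaw ν f φ θ → ∀ s t, s < t → θ' s t = θ s t

/-- The space `ℝ^{p-1}` of parameters `θₛ = (θₛₜ)_{t ≠ s}`, with the Euclidean norm. -/
abbrev NodeParam {p : ℕ} (s : Fin p) : Type := EuclideanSpace ℝ {t : Fin p // t ≠ s}

/-- The vector `θₛ = (θₛₜ)_{t ≠ s}` of a parameter array `θ`. -/
def nodeParam {p : ℕ} (θ : Fin p → Fin p → ℝ) (s : Fin p) : NodeParam s :=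
  WithLp.toLp 2 fun t => θ s t

/-- `‖θₛ‖₁`. -/
def l1Norm {p : ℕ} {s : Fin p} (θs : NodeParam s) : ℝ := ∑ t, |θs t|

/-- `‖θₛ‖₀`, the number of nonzero entries. -/
def l0Norm {p : ℕ} {s : Fin p} (θs : NodeParam s) : ℕ := {t | θs t ≠ 0}.ncard

/-- The exponent of the node-conditional law of `Xₛ = u` given the other coordinates of `x`
(the entry `x s` is not used). -/
def nodeExponent {𝒳 : Type*} {p : ℕ} (f : 𝒳 → ℝ) (φ : 𝒳 → 𝒳 → ℝ) {s : Fin p}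
    (θs : NodeParam s) (u : 𝒳) (x : Fin p → 𝒳) : ℝ :=
  f u + ∑ t : {t : Fin p // t ≠ s}, θs t * φ u (x t)

/-- The conditional log-partition function `D(x_{∖s}; θₛ)`. -/
def nodeLogPartition {𝒳 : Type*} [MeasurableSpace 𝒳] (ν : Measure 𝒳) {p : ℕ} (f : 𝒳 → ℝ)
    (φ : 𝒳 → 𝒳 → ℝ) {s : Fin p} (θs : NodeParam s) (x : Fin p → 𝒳) : ℝ :=
  Real.log (∫ u, Real.exp (nodeExponent f φ θs u x) ∂ν)

/-- The conditional density of `Xₛ` given `X_{∖s}`, at the point `x`. -/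
def nodeDensity {𝒳 : Type*} [MeasurableSpace 𝒳] (ν : Measure 𝒳) {p : ℕ} (f : 𝒳 → ℝ)
    (φ : 𝒳 → 𝒳 → ℝ) {s : Fin p} (θs : NodeParam s) (x : Fin p → 𝒳) : ℝ :=
  Real.exp (nodeExponent f φ θs (x s) x - nodeLogPartition ν f φ θs x)

/-- The node-wise negative conditional log-likelihood of the sample `X⁽¹⁾, …, X⁽ⁿ⁾`. -/
def nodeLoss {𝒳 : Type*} [MeasurableSpace 𝒳] (ν : Measure 𝒳) {p n : ℕ} (f : 𝒳 → ℝ)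
    (φ : 𝒳 → 𝒳 → ℝ) {s : Fin p} (X : Fin n → Fin p → 𝒳) (θs : NodeParam s) : ℝ :=
  -(1 / (n : ℝ)) * ∑ i, Real.log (nodeDensity ν f φ θs (X i))

/-- The maximum norm of the gradient of the node-wise loss at `θₛ`. -/
def nodeGradSup {𝒳 : Type*} [MeasurableSpace 𝒳] (ν : Measure 𝒳) {p n : ℕ} (f : 𝒳 → ℝ)
    (φ : 𝒳 → 𝒳 → ℝ) {s : Fin p} (X : Fin n → Fin p → 𝒳) (θs : NodeParam s) : ℝ :=
  ⨆ t, |gradient (nodeLoss ν f φ X) θs t|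

/-- `argmin` of the `ℓ₁`-penalized node-wise loss over all of `ℝ^{p-1}`. -/
def nodeEstimators {𝒳 : Type*} [MeasurableSpace 𝒳] (ν : Measure 𝒳) {p n : ℕ} (f : 𝒳 → ℝ)
    (φ : 𝒳 → 𝒳 → ℝ) (s : Fin p) (X : Fin n → Fin p → 𝒳) (lam : ℝ) : Set (NodeParam s) :=
  {θs | ∀ θs' : NodeParam s,
    nodeLoss ν f φ X θs + lam * l1Norm θs ≤ nodeLoss ν f φ X θs' + lam * l1Norm θs'}

end SemiEFGM

end

/-!
Up to an affine term, the node-wise loss is an average of log-moment generating functions of the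
conditional laws, so convexity alone makes an `ℓ₁`-penalized minimizer accurate as soon as (a) its
gradient at the truth is small and (b) its Bregman remainder is bounded below by `m ‖Δ‖²` on the
unit ball.

For (a), the score is centred conditionally on the other nodes, and its second moments are finite
because `A` is finite near `θ*`; Chebyshev's inequality makes it `O(n^(-1/2))`. For (b), on the
unit ball the remainder dominates the conditional second moment of `⟪Δ, G⟫` damped by `exp (-‖G‖)`,
`G` being the centred sufficient statistic. This is a quadratic form in `Δ` with bounded
coefficients, so its sample average is close to its mean, and it remains to see that the mean is
positive definite. If it vanished at some `Δ ≠ 0`, the conditional law of `X_s` would not see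
`⟪Δ, G⟫`; then `φ` would be a.e. a sum of functions of one variable, hence constant by the Mercer
property, and a shift of one entry of `θ*` would leave the joint law unchanged, contradicting
minimality.

The constant does not depend on `c₀` because the penalty enters the error bound linearly.
-/

noncomputable section

namespace SemiEFGM

open scoped RealInnerProductSpace ENNReal

open ProbabilityTheory

section ScalarBounds

variable {r : ℝ}

theorem sq_mul_exp_neg_le_two (hr : 0 ≤ r) : r ^ 2 * Real.exp (-r) ≤ 2 := by
  rw [Real.exp_neg, ← div_eq_mul_inv, div_le_iff₀ (Real.exp_pos r)]
  linarith [Real.quadratic_le_exp_of_nonneg hr]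

theorem sq_mul_exp_le_two_mul_exp (hr : 0 ≤ r) : r ^ 2 * Real.exp r ≤ 2 * Real.exp (2 * r) := by
  rw [two_mul r, Real.exp_add, ← mul_assoc]
  gcongr
  linarith [Real.quadratic_le_exp_of_nonneg hr]

theorem exp_sub_one_sub_le (y : ℝ) : Real.exp y - 1 - y ≤ y ^ 2 * Real.exp |y| := by
  have h := Complex.norm_exp_sub_sum_le_norm_mul_exp y 2
  simp only [Finset.sum_range_succ, Finset.sum_range_zero, Complex.norm_real] at h
  norm_cast at h
  simp only [Real.norm_eq_abs, sq_abs, zero_add, pow_zero, pow_one, Nat.factorial_zero,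
    Nat.factorial_one, Nat.cast_one, div_one] at h
  linarith [le_abs_self (Real.exp y - (1 + y))]

theorem quarter_sq_mul_exp_neg_abs_le (y : ℝ) :
    y ^ 2 / 4 * Real.exp (-|y|) ≤ Real.exp y - 1 - y := by
  have hexp : Real.exp (-|y|) ≤ 1 := Real.exp_le_one_iff.2 (by simp)
  rcases le_or_gt (-2) y with hy | hy
  · have hquarter : y ^ 2 / 4 ≤ Real.exp y - 1 - y := by
      rcases le_or_gt 0 y with hy₀ | _
      · linarith [Real.quadratic_le_exp_of_nonneg hy₀, sq_nonneg y]
      · have hhalf : (y / 2 + 1) ^ 2 ≤ Real.exp (y / 2) ^ 2 :=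
          pow_le_pow_left₀ (by linarith) (Real.add_one_le_exp _) 2
        rw [← Real.exp_nat_mul, Nat.cast_ofNat, mul_div_cancel₀ y two_ne_zero] at hhalf
        linarith
    exact (mul_le_of_le_one_right (by positivity) hexp).trans hquarter
  · have htwo := sq_mul_exp_neg_le_two (abs_nonneg y)
    rw [sq_abs] at htwo
    linarith [Real.exp_pos y]

theorem half_le_log_one_add (hr : 0 ≤ r) (hr2 : r ≤ 2) : r / 2 ≤ Real.log (1 + r) := by
  refine le_trans ?_ (Real.le_log_one_add_of_nonneg hr)
  rw [div_le_div_iff₀ two_pos (by linarith)]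
  nlinarith

end ScalarBounds

section ExponentialMoments

variable {Ω E : Type*} [MeasurableSpace Ω] [NormedAddCommGroup E] {P : Measure Ω} {G : Ω → E}

/-- All exponential moments of the norm of the random vector `G` under `P` are finite. -/
structure HasExpMoments (P : Measure Ω) (G : Ω → E) : Prop where
  aestronglyMeasurable : AEStronglyMeasurable G P
  integrable_exp_mul_norm (a : ℝ) : Integrable (fun ω => Real.exp (a * ‖G ω‖)) P

namespace HasExpMoments

theorem integrable_of_norm_le {F : Type*} [NormedAddCommGroup F] (hG : HasExpMoments P G)
    {g : Ω → F} (hg : AEStronglyMeasurable g P) (a c : ℝ)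
    (h : ∀ ω, ‖g ω‖ ≤ c * Real.exp (a * ‖G ω‖)) : Integrable g P :=
  ((hG.integrable_exp_mul_norm a).const_mul c).mono' hg (Eventually.of_forall h)

theorem integrable (hG : HasExpMoments P G) : Integrable G P :=
  hG.integrable_of_norm_le hG.aestronglyMeasurable 1 1 fun ω => by
    rw [one_mul, one_mul]
    linarith [Real.add_one_le_exp ‖G ω‖]

theorem integrable_norm_sq_mul_exp (hG : HasExpMoments P G) :
    Integrable (fun ω => ‖G ω‖ ^ 2 * Real.exp ‖G ω‖) P := by
  have hnorm := hG.aestronglyMeasurable.norm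
  refine hG.integrable_of_norm_le
    ((hnorm.pow 2).mul (Real.continuous_exp.comp_aestronglyMeasurable hnorm)) 2 2 fun ω => ?_
  rw [Real.norm_of_nonneg (by positivity)]
  exact sq_mul_exp_le_two_mul_exp (norm_nonneg _)

theorem sub_const (hG : HasExpMoments P G) (m : E) : HasExpMoments P (fun ω => G ω - m) := by
  have hm : AEStronglyMeasurable (fun ω => G ω - m) P :=
    hG.aestronglyMeasurable.sub aestronglyMeasurable_const
  refine ⟨hm, fun a => hG.integrable_of_norm_le
    (Real.continuous_exp.comp_aestronglyMeasurable (hm.norm.const_mul a)) |a|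
    (Real.exp (|a| * ‖m‖)) fun ω => ?_⟩
  rw [Real.norm_eq_abs, Real.abs_exp, ← Real.exp_add]
  refine Real.exp_le_exp.2 ?_
  calc a * ‖G ω - m‖ ≤ |a| * ‖G ω - m‖ := by gcongr; exact le_abs_self a
    _ ≤ |a| * (‖G ω‖ + ‖m‖) := by gcongr; exact norm_sub_le _ _
    _ = |a| * ‖m‖ + |a| * ‖G ω‖ := by ring

theorem integrable_exp_inner [InnerProductSpace ℝ E] (hG : HasExpMoments P G) (Δ : E) :
    Integrable (fun ω => Real.exp ⟪Δ, G ω⟫) P :=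
  hG.integrable_of_norm_le (Real.continuous_exp.comp_aestronglyMeasurable
    (aestronglyMeasurable_const.inner hG.aestronglyMeasurable)) ‖Δ‖ 1 fun ω => by
      rw [Real.norm_eq_abs, Real.abs_exp, one_mul]
      exact Real.exp_le_exp.2 (real_inner_le_norm _ _)

end HasExpMoments

end ExponentialMoments

section LogMGF

variable {Ω E : Type*} [MeasurableSpace Ω] [NormedAddCommGroup E] [InnerProductSpace ℝ E]
  {P : Measure Ω} {G : Ω → E} {Δ : E}

/-- The logarithmic moment generating function of the random vector `G`. -/
def logMGF (P : Measure Ω) (G : Ω → E) (Δ : E) : ℝ := Real.log (∫ ω, Real.exp ⟪Δ, G ω⟫ ∂P)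

/-- The second moment of `⟪Δ, G⟫` damped by `exp (-‖G‖)`. It is a lower bound for the curvature
of `logMGF P G` on the whole unit ball, and the damping makes it bounded, so that its sample
averages concentrate. -/
def dampedSecondMoment (P : Measure Ω) (G : Ω → E) (Δ : E) : ℝ :=
  ∫ ω, ⟪Δ, G ω⟫ ^ 2 * Real.exp (-‖G ω‖) ∂P

theorem inner_sq_mul_exp_neg_norm_le (Δ v : E) :
    ⟪Δ, v⟫ ^ 2 * Real.exp (-‖v‖) ≤ 2 * ‖Δ‖ ^ 2 :=
  calc ⟪Δ, v⟫ ^ 2 * Real.exp (-‖v‖) ≤ (‖Δ‖ * ‖v‖) ^ 2 * Real.exp (-‖v‖) := by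
        gcongr ?_ * _
        rw [← sq_abs]
        gcongr
        exact abs_real_inner_le_norm _ _
    _ = ‖Δ‖ ^ 2 * (‖v‖ ^ 2 * Real.exp (-‖v‖)) := by ring
    _ ≤ ‖Δ‖ ^ 2 * 2 := by gcongr; exact sq_mul_exp_neg_le_two (norm_nonneg v)
    _ = 2 * ‖Δ‖ ^ 2 := mul_comm _ _

theorem dampedSecondMoment_smul (r : ℝ) :
    dampedSecondMoment P G (r • Δ) = r ^ 2 * dampedSecondMoment P G Δ := by
  simp only [dampedSecondMoment, real_inner_smul_left, mul_pow, mul_assoc, integral_const_mul]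

theorem dampedSecondMoment_nonneg : 0 ≤ dampedSecondMoment P G Δ :=
  integral_nonneg fun _ => by positivity

theorem integrable_inner_sq_mul_exp_neg_norm [IsFiniteMeasure P] (hG : AEStronglyMeasurable G P)
    (Δ : E) : Integrable (fun ω => ⟪Δ, G ω⟫ ^ 2 * Real.exp (-‖G ω‖)) P := by
  refine (integrable_const (2 * ‖Δ‖ ^ 2)).mono'
    (((aestronglyMeasurable_const.inner hG).pow 2).mul
      (Real.continuous_exp.comp_aestronglyMeasurable hG.norm.neg))
    (Eventually.of_forall fun ω => ?_)
  rw [Real.norm_of_nonneg (by positivity)]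
  exact inner_sq_mul_exp_neg_norm_le _ _

theorem ae_inner_eq_zero_of_dampedSecondMoment_eq_zero [IsFiniteMeasure P]
    (hG : AEStronglyMeasurable G P) (h : dampedSecondMoment P G Δ = 0) :
    ∀ᵐ ω ∂P, ⟪Δ, G ω⟫ = 0 := by
  filter_upwards [(integral_eq_zero_iff_of_nonneg (fun _ => by positivity)
    (integrable_inner_sq_mul_exp_neg_norm hG Δ)).1 h] with ω hω
  simpa using hω

theorem logMGF_sub_const [NeZero P] (hG : HasExpMoments P G) (Δ m : E) :
    logMGF P (fun ω => G ω - m) Δ = logMGF P G Δ - ⟪Δ, m⟫ := by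
  have hexp : ∀ ω, Real.exp ⟪Δ, G ω - m⟫ = Real.exp ⟪Δ, G ω⟫ * Real.exp (-⟪Δ, m⟫) := fun ω => by
    rw [inner_sub_right, sub_eq_add_neg, Real.exp_add]
  rw [logMGF, integral_congr_ae (Eventually.of_forall hexp), integral_mul_const,
    Real.log_mul (integral_exp_pos (hG.integrable_exp_inner Δ)).ne' (Real.exp_pos _).ne',
    Real.log_exp, logMGF, sub_eq_add_neg]

variable [IsProbabilityMeasure P]

theorem mul_logMGF_le_logMGF_smul (hG : HasExpMoments P G) (Δ : E) {τ : ℝ} (hτ : 1 ≤ τ) :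
    τ * logMGF P G Δ ≤ logMGF P G (τ • Δ) := by
  have hpos := integral_exp_pos (hG.integrable_exp_inner Δ)
  have hpow : ∀ ω, Real.exp ⟪Δ, G ω⟫ ^ τ = Real.exp ⟪τ • Δ, G ω⟫ := fun ω => by
    rw [← Real.exp_mul, real_inner_smul_left, mul_comm]
  have jensen := (convexOn_rpow hτ).map_integral_le (μ := P) (f := fun ω => Real.exp ⟪Δ, G ω⟫)
    (Real.continuous_rpow_const (by linarith)).continuousOn isClosed_Ici
    (Eventually.of_forall fun ω => (Real.exp_pos _).le) (hG.integrable_exp_inner Δ)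
    (by simpa only [Function.comp_def, hpow] using hG.integrable_exp_inner (τ • Δ))
  simp only [hpow] at jensen
  rw [logMGF, ← Real.log_rpow hpos]
  exact Real.log_le_log (Real.rpow_pos_of_pos hpos _) jensen

theorem integrable_exp_inner_sub_one_sub (hG : HasExpMoments P G) (Δ : E) :
    Integrable (fun ω => Real.exp ⟪Δ, G ω⟫ - 1 - ⟪Δ, G ω⟫) P :=
  ((hG.integrable_exp_inner Δ).sub (integrable_const 1)).sub (hG.integrable.const_inner Δ)

variable [CompleteSpace E]

theorem integral_exp_inner_sub_one_sub (hG : HasExpMoments P G) (hG₀ : ∫ ω, G ω ∂P = 0) (Δ : E) :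
    ∫ ω, (Real.exp ⟪Δ, G ω⟫ - 1 - ⟪Δ, G ω⟫) ∂P = ∫ ω, Real.exp ⟪Δ, G ω⟫ ∂P - 1 := by
  have hexp := hG.integrable_exp_inner Δ
  have hexp_sub : Integrable (fun ω => Real.exp ⟪Δ, G ω⟫ - 1) P := hexp.sub (integrable_const 1)
  rw [integral_sub hexp_sub (hG.integrable.const_inner Δ), integral_sub hexp (integrable_const 1),
    integral_inner hG.integrable, hG₀]
  simp

theorem quarter_dampedSecondMoment_le (hG : HasExpMoments P G) (hG₀ : ∫ ω, G ω ∂P = 0)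
    (hΔ : ‖Δ‖ ≤ 1) :
    1 / 4 * dampedSecondMoment P G Δ ≤ ∫ ω, Real.exp ⟪Δ, G ω⟫ ∂P - 1 := by
  rw [← integral_exp_inner_sub_one_sub hG hG₀, dampedSecondMoment, ← integral_const_mul]
  refine integral_mono
    ((integrable_inner_sq_mul_exp_neg_norm hG.aestronglyMeasurable Δ).const_mul _)
    (integrable_exp_inner_sub_one_sub hG Δ)
    fun ω => le_trans ?_ (quarter_sq_mul_exp_neg_abs_le _)
  have hinner : |⟪Δ, G ω⟫| ≤ ‖G ω‖ :=
    (abs_real_inner_le_norm _ _).trans (mul_le_of_le_one_left (norm_nonneg _) hΔ)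
  calc 1 / 4 * (⟪Δ, G ω⟫ ^ 2 * Real.exp (-‖G ω‖))
      = ⟪Δ, G ω⟫ ^ 2 / 4 * Real.exp (-‖G ω‖) := by ring
    _ ≤ ⟪Δ, G ω⟫ ^ 2 / 4 * Real.exp (-|⟪Δ, G ω⟫|) := by gcongr

theorem eighth_dampedSecondMoment_le_logMGF (hG : HasExpMoments P G) (hG₀ : ∫ ω, G ω ∂P = 0)
    (hΔ : ‖Δ‖ ≤ 1) : 1 / 8 * dampedSecondMoment P G Δ ≤ logMGF P G Δ := by
  have hnonneg : 0 ≤ dampedSecondMoment P G Δ := dampedSecondMoment_nonneg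
  have hle : dampedSecondMoment P G Δ ≤ 2 := by
    calc dampedSecondMoment P G Δ ≤ ∫ _, (2 : ℝ) ∂P :=
          integral_mono (integrable_inner_sq_mul_exp_neg_norm hG.aestronglyMeasurable Δ)
            (integrable_const _) fun ω => (inner_sq_mul_exp_neg_norm_le Δ (G ω)).trans
              (mul_le_of_le_one_right two_pos.le (pow_le_one₀ (norm_nonneg Δ) hΔ))
      _ = 2 := by simp
  calc 1 / 8 * dampedSecondMoment P G Δ = 1 / 4 * dampedSecondMoment P G Δ / 2 := by ring
    _ ≤ Real.log (1 + 1 / 4 * dampedSecondMoment P G Δ) :=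
      half_le_log_one_add (by positivity) (by linarith)
    _ ≤ logMGF P G Δ :=
      Real.log_le_log (by positivity) (by linarith [quarter_dampedSecondMoment_le hG hG₀ hΔ])

theorem logMGF_le_mul_norm_sq (hG : HasExpMoments P G) (hG₀ : ∫ ω, G ω ∂P = 0) (hΔ : ‖Δ‖ ≤ 1) :
    logMGF P G Δ ≤ (∫ ω, ‖G ω‖ ^ 2 * Real.exp ‖G ω‖ ∂P) * ‖Δ‖ ^ 2 := by
  refine (Real.log_le_sub_one_of_pos (integral_exp_pos (hG.integrable_exp_inner Δ))).trans ?_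
  rw [← integral_exp_inner_sub_one_sub hG hG₀, ← integral_mul_const]
  refine integral_mono (integrable_exp_inner_sub_one_sub hG Δ)
    (hG.integrable_norm_sq_mul_exp.mul_const _) fun ω => (exp_sub_one_sub_le _).trans ?_
  have hinner := abs_real_inner_le_norm Δ (G ω)
  calc ⟪Δ, G ω⟫ ^ 2 * Real.exp |⟪Δ, G ω⟫|
      ≤ (‖Δ‖ * ‖G ω‖) ^ 2 * Real.exp ‖G ω‖ := by
        rw [← sq_abs]
        gcongr
        exact hinner.trans (mul_le_of_le_one_left (norm_nonneg _) hΔ)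
    _ = ‖G ω‖ ^ 2 * Real.exp ‖G ω‖ * ‖Δ‖ ^ 2 := by ring

end LogMGF

section LocalCurvature

variable {E : Type*} [NormedAddCommGroup E] {F R : E → ℝ} {θ : E} {b m : ℝ}

/-- The remainder `R` is bounded below by `m ‖Δ‖²` on the unit ball, and it is star-shaped, so
that the bound propagates linearly beyond the ball. -/
structure HasLocalCurvature [NormedSpace ℝ E] (R : E → ℝ) (m : ℝ) : Prop where
  mul_norm_sq_le : ∀ Δ, ‖Δ‖ ≤ 1 → m * ‖Δ‖ ^ 2 ≤ R Δ
  mul_le_smul : ∀ Δ (τ : ℝ), 1 ≤ τ → τ * R Δ ≤ R (τ • Δ)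

theorem HasLocalCurvature.mul_norm_le [NormedSpace ℝ E] (hR : HasLocalCurvature R m) {Δ : E}
    (hΔ : 1 ≤ ‖Δ‖) : m * ‖Δ‖ ≤ R Δ := by
  have hpos : 0 < ‖Δ‖ := one_pos.trans_le hΔ
  have hunit : ‖‖Δ‖⁻¹ • Δ‖ = 1 := by rw [norm_smul, norm_inv, norm_norm, inv_mul_cancel₀ hpos.ne']
  calc m * ‖Δ‖ = ‖Δ‖ * (m * ‖‖Δ‖⁻¹ • Δ‖ ^ 2) := by rw [hunit]; ring
    _ ≤ ‖Δ‖ * R (‖Δ‖⁻¹ • Δ) := by gcongr; exact hR.mul_norm_sq_le _ hunit.le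
    _ ≤ R (‖Δ‖ • ‖Δ‖⁻¹ • Δ) := hR.mul_le_smul _ _ hΔ
    _ = R Δ := by rw [smul_inv_smul₀ hpos.ne']

theorem exists_forall_le_of_forall_one_le_norm [ProperSpace E] (hF : Continuous F)
    (hfar : ∀ Δ, 1 ≤ ‖Δ‖ → F θ ≤ F (θ + Δ)) : ∃ θ₁, ∀ θ₂, F θ₁ ≤ F θ₂ := by
  refine hF.exists_forall_le' θ ?_
  filter_upwards [(isCompact_closedBall θ 1).compl_mem_cocompact] with θ₂ hθ₂
  rw [Set.mem_compl_iff, Metric.mem_closedBall, dist_eq_norm, not_le] at hθ₂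
  simpa using hfar (θ₂ - θ) hθ₂.le

variable [NormedSpace ℝ E]

theorem HasLocalCurvature.exists_forall_le [ProperSpace E] (hR : HasLocalCurvature R m)
    (hF : Continuous F) (hFR : ∀ Δ, R Δ - b * ‖Δ‖ ≤ F (θ + Δ) - F θ) (hbm : b < m) :
    ∃ θ₁, ∀ θ₂, F θ₁ ≤ F θ₂ :=
  exists_forall_le_of_forall_one_le_norm (θ := θ) hF fun Δ hΔ => by
    nlinarith [hFR Δ, hR.mul_norm_le hΔ]

theorem HasLocalCurvature.norm_sub_le_div (hR : HasLocalCurvature R m)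
    (hFR : ∀ Δ, R Δ - b * ‖Δ‖ ≤ F (θ + Δ) - F θ) (hb : 0 ≤ b) (hbm : b < m) {θ₁ : E}
    (hθ₁ : F θ₁ ≤ F θ) : ‖θ₁ - θ‖ ≤ b / m := by
  have hFR₁ := hFR (θ₁ - θ)
  rw [add_sub_cancel] at hFR₁
  rw [le_div_iff₀ (hb.trans_lt hbm)]
  rcases le_total 1 ‖θ₁ - θ‖ with hfar | hnear
  · nlinarith [hR.mul_norm_le hfar]
  · rcases (norm_nonneg (θ₁ - θ)).eq_or_lt with hzero | hpos
    · rwa [← hzero, zero_mul]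
    · refine le_of_mul_le_mul_right ?_ hpos
      nlinarith [hR.mul_norm_sq_le _ hnear]

end LocalCurvature

section Bregman

variable {E : Type*} [NormedAddCommGroup E] [InnerProductSpace ℝ E]

/-- The remainder of the first-order expansion of `L` at `θ` with slope `g`, as a function of the
increment; for `g = ∇ L θ` it is the Bregman divergence of `L`. -/
def bregmanRemainder (L : E → ℝ) (g θ Δ : E) : ℝ := L (θ + Δ) - L θ - ⟪g, Δ⟫

theorem hasGradientAt_of_abs_bregmanRemainder_le [CompleteSpace E] {L : E → ℝ} {g θ : E} {C : ℝ}
    (h : ∀ Δ : E, ‖Δ‖ ≤ 1 → |bregmanRemainder L g θ Δ| ≤ C * ‖Δ‖ ^ 2) :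
    HasGradientAt L g θ := by
  rw [hasGradientAt_iff_isLittleO_nhds_zero]
  refine Asymptotics.IsBigO.trans_isLittleO (.of_bound C ?_)
    (Asymptotics.isLittleO_norm_pow_id one_lt_two)
  filter_upwards [Metric.closedBall_mem_nhds (0 : E) one_pos] with Δ hΔ
  rw [Real.norm_eq_abs, norm_pow, norm_norm]
  exact h Δ (by simpa using hΔ)

end Bregman

section Lasso

variable {ι : Type*} [Fintype ι] {L : EuclideanSpace ℝ ι → ℝ} {θ g Δ : EuclideanSpace ℝ ι}
  {lam m : ℝ}

/-- The loss `L` with an `ℓ₁` penalty of weight `lam`. -/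
def lassoObjective (L : EuclideanSpace ℝ ι → ℝ) (lam : ℝ) (θ : EuclideanSpace ℝ ι) : ℝ :=
  L θ + lam * ∑ t, |θ t|

theorem sum_abs_support_le (θ Δ : EuclideanSpace ℝ ι) :
    ∑ t with θ t ≠ 0, |Δ t| ≤ √({t | θ t ≠ 0}.ncard : ℝ) * ‖Δ‖ := by
  classical
  have hcard : {t | θ t ≠ 0}.ncard = (Finset.univ.filter fun t => θ t ≠ 0).card := by
    rw [← Set.ncard_coe_finset, Finset.coe_filter_univ]
  rw [hcard, EuclideanSpace.norm_eq, ← Real.sqrt_mul (Nat.cast_nonneg _)]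
  refine Real.le_sqrt_of_sq_le (sq_sum_le_card_mul_sum_sq.trans ?_)
  simp only [sq_abs, Real.norm_eq_abs]
  gcongr
  exact Finset.filter_subset _ _

theorem neg_mul_add_penalty_sub_le {c a d : ℝ} (hlam : 0 ≤ lam) (hc : |c| ≤ lam / 2) :
    -(c * d) + lam * |a| - lam * |a + d| ≤ if a ≠ 0 then 3 / 2 * lam * |d| else 0 := by
  have hcd : -(c * d) ≤ lam / 2 * |d| := by
    refine (neg_le_abs _).trans ?_
    rw [abs_mul]
    gcongr
  split_ifs with ha
  · have htri : |a| - |a + d| ≤ |d| := by simpa using abs_sub_abs_le_abs_sub a (a + d)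
    linarith [mul_le_mul_of_nonneg_left htri hlam]
  · obtain rfl : a = 0 := not_not.1 ha
    rw [abs_zero, mul_zero, zero_add]
    linarith [mul_nonneg hlam (abs_nonneg d)]

theorem bregmanRemainder_sub_le_lassoObjective_sub (hlam : 0 ≤ lam) (hg : ∀ t, |g t| ≤ lam / 2) :
    bregmanRemainder L g θ Δ - 3 / 2 * lam * √({t | θ t ≠ 0}.ncard : ℝ) * ‖Δ‖
      ≤ lassoObjective L lam (θ + Δ) - lassoObjective L lam θ := by
  have hinner : ⟪g, Δ⟫ = ∑ t, g t * Δ t := by simp [PiLp.inner_apply, mul_comm]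
  have hlinear : -⟪g, Δ⟫ + lam * ∑ t, |θ t| - lam * ∑ t, |(θ + Δ) t|
      ≤ 3 / 2 * lam * √({t | θ t ≠ 0}.ncard : ℝ) * ‖Δ‖ :=
    calc -⟪g, Δ⟫ + lam * ∑ t, |θ t| - lam * ∑ t, |(θ + Δ) t|
        = ∑ t, (-(g t * Δ t) + lam * |θ t| - lam * |θ t + Δ t|) := by
          rw [hinner, Finset.mul_sum, Finset.mul_sum, ← Finset.sum_neg_distrib,
            ← Finset.sum_add_distrib, ← Finset.sum_sub_distrib]
          rfl
      _ ≤ ∑ t, if θ t ≠ 0 then 3 / 2 * lam * |Δ t| else 0 :=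
          Finset.sum_le_sum fun t _ => neg_mul_add_penalty_sub_le hlam (hg t)
      _ = 3 / 2 * lam * ∑ t with θ t ≠ 0, |Δ t| := by
          rw [← Finset.sum_filter, Finset.mul_sum]
      _ ≤ 3 / 2 * lam * (√({t | θ t ≠ 0}.ncard : ℝ) * ‖Δ‖) := by
          gcongr
          exact sum_abs_support_le θ Δ
      _ = 3 / 2 * lam * √({t | θ t ≠ 0}.ncard : ℝ) * ‖Δ‖ := (mul_assoc _ _ _).symm
  simp only [bregmanRemainder, lassoObjective]
  linarith

variable (hlam : 0 ≤ lam) (hg : ∀ t, |g t| ≤ lam / 2)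
  (hR : HasLocalCurvature (bregmanRemainder L g θ) m)
  (hsmall : 3 / 2 * lam * √({t | θ t ≠ 0}.ncard : ℝ) < m)
include hlam hg hR hsmall

theorem exists_lassoObjective_le (hL : Continuous L) :
    ∃ θ₁, ∀ θ₂, lassoObjective L lam θ₁ ≤ lassoObjective L lam θ₂ :=
  hR.exists_forall_le (hL.add (continuous_const.mul (by fun_prop)))
    (fun _ => bregmanRemainder_sub_le_lassoObjective_sub hlam hg) hsmall

theorem norm_sub_le_of_lassoObjective_le {θ₁ : EuclideanSpace ℝ ι}
    (hθ₁ : lassoObjective L lam θ₁ ≤ lassoObjective L lam θ) :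
    ‖θ₁ - θ‖ ≤ 3 / 2 * lam * √({t | θ t ≠ 0}.ncard : ℝ) / m :=
  hR.norm_sub_le_div (fun _ => bregmanRemainder_sub_le_lassoObjective_sub hlam hg)
    (by positivity) hsmall hθ₁

end Lasso

section Sampling

variable {Ω : Type*}

/-- The sample mean of the statistic `g`. -/
def sampleMean {n : ℕ} (g : Ω → ℝ) (X : Fin n → Ω) : ℝ := 1 / (n : ℝ) * ∑ i, g (X i)

variable [MeasurableSpace Ω] {J : Measure Ω} [IsProbabilityMeasure J] {n : ℕ} {g : Ω → ℝ} {ε : ℝ}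

theorem memLp_sampleMean (hg : MemLp g 2 J) :
    MemLp (sampleMean g) 2 (Measure.pi fun _ : Fin n => J) :=
  (memLp_finsetSum _ fun i _ =>
    hg.comp_measurePreserving (measurePreserving_eval (fun _ : Fin n => J) i)).const_mul _

theorem integral_sampleMean (hg : Integrable g J) (hn : n ≠ 0) :
    ∫ X, sampleMean g X ∂(Measure.pi fun _ : Fin n => J) = ∫ x, g x ∂J := by
  simp only [sampleMean]
  rw [integral_const_mul, integral_finsetSum _ fun i _ => integrable_comp_eval hg,
    Finset.sum_congr rfl fun i _ =>
      integral_comp_eval (μ := fun _ : Fin n => J) hg.aestronglyMeasurable,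
    Finset.sum_const, Finset.card_univ, Fintype.card_fin, nsmul_eq_mul, ← mul_assoc,
    one_div_mul_cancel (Nat.cast_ne_zero.2 hn), one_mul]

theorem variance_sampleMean (hg : MemLp g 2 J) :
    variance (sampleMean g) (Measure.pi fun _ : Fin n => J) = variance g J / n := by
  have hsum : (fun X : Fin n → Ω => ∑ i, g (X i)) = ∑ i, fun X => g (X i) := by
    ext X
    rw [Finset.sum_apply]
  have hmean : (sampleMean g : (Fin n → Ω) → ℝ) = fun X => 1 / (n : ℝ) * ∑ i, g (X i) := rfl
  rw [hmean, variance_const_mul, hsum, variance_sum_pi fun _ => hg, Finset.sum_const,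
    Finset.card_univ, Fintype.card_fin, nsmul_eq_mul]
  rcases eq_or_ne (n : ℝ) 0 with hn | hn
  · simp only [hn, div_zero, zero_mul, mul_zero]
  · field_simp

theorem measure_sampleMean_deviation_le (hg : MemLp g 2 J) (hn : n ≠ 0) (hε : 0 < ε) :
    (Measure.pi fun _ : Fin n => J) {X | ε ≤ |sampleMean g X - ∫ x, g x ∂J|}
      ≤ ENNReal.ofReal (variance g J / (n * ε ^ 2)) := by
  have chebyshev := meas_ge_le_variance_div_sq (memLp_sampleMean (n := n) hg) hε
  rwa [integral_sampleMean (hg.integrable one_le_two) hn, variance_sampleMean hg, div_div]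
    at chebyshev

theorem measure_exists_sampleMean_deviation_le {ι : Type*} [Fintype ι] {g : ι → Ω → ℝ}
    (hg : ∀ k, MemLp (g k) 2 J) (hn : n ≠ 0) (hε : 0 < ε) :
    (Measure.pi fun _ : Fin n => J) {X | ∃ k, ε ≤ |sampleMean (g k) X - ∫ x, g k x ∂J|}
      ≤ ENNReal.ofReal ((∑ k, variance (g k) J) / (n * ε ^ 2)) := by
  rw [Set.ofPred_exists, Finset.sum_div,
    ENNReal.ofReal_sum_of_nonneg fun k _ => div_nonneg (variance_nonneg _ _) (by positivity)]
  exact (measure_iUnion_fintype_le _ _).trans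
    (Finset.sum_le_sum fun k _ => measure_sampleMean_deviation_le (hg k) hn hε)

end Sampling

section PairSums

variable {ι Ω : Type*} [Fintype ι] [MeasurableSpace Ω] {μ : Measure Ω} [IsProbabilityMeasure μ]

theorem measurePreserving_eval_pair {i j : ι} (hij : i ≠ j) :
    MeasurePreserving (fun ω : ι → Ω => (ω i, ω j)) (Measure.pi fun _ => μ) (μ.prod μ) := by
  refine ⟨by fun_prop, ?_⟩
  have hindep := (iIndepFun_pi (μ := fun _ : ι => μ) (X := fun _ ω => ω)
    fun _ => aemeasurable_id).indepFun hij
  have hmap := (indepFun_iff_map_prod_eq_prod_map_map (measurable_pi_apply i).aemeasurable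
    (measurable_pi_apply j).aemeasurable).1 hindep
  rwa [(measurePreserving_eval (fun _ : ι => μ) i).map_eq,
    (measurePreserving_eval (fun _ : ι => μ) j).map_eq] at hmap

variable {K : Ω → Ω → ℝ}

theorem integral_eval_pair (hK : Integrable (Function.uncurry K) (μ.prod μ)) {i j : ι}
    (hij : i ≠ j) :
    ∫ ω, K (ω i) (ω j) ∂(Measure.pi fun _ : ι => μ) = ∫ z, K z.1 z.2 ∂(μ.prod μ) := by
  have hpair := measurePreserving_eval_pair (μ := μ) hij
  have hmap := integral_map hpair.measurable.aemeasurable (f := Function.uncurry K)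
    (by rw [hpair.map_eq]; exact hK.aestronglyMeasurable)
  rw [hpair.map_eq] at hmap
  exact hmap.symm

theorem integral_sum_sum_eval (hdiag : Integrable (fun u => K u u) μ)
    (hK : Integrable (Function.uncurry K) (μ.prod μ)) :
    ∫ ω, ∑ i, ∑ j, K (ω i) (ω j) ∂(Measure.pi fun _ : ι => μ)
      = Fintype.card ι * ∫ u, K u u ∂μ
        + Fintype.card ι * (Fintype.card ι - 1) * ∫ z, K z.1 z.2 ∂(μ.prod μ) := by
  classical
  set D := ∫ u, K u u ∂μ
  set I := ∫ z, K z.1 z.2 ∂(μ.prod μ)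
  have hint : ∀ i j, Integrable (fun ω : ι → Ω => K (ω i) (ω j)) (Measure.pi fun _ => μ) := by
    intro i j
    rcases eq_or_ne i j with rfl | hij
    · exact integrable_comp_eval (μ := fun _ : ι => μ) hdiag
    · exact (measurePreserving_eval_pair hij).integrable_comp_of_integrable hK
  have hentry : ∀ i j, ∫ ω, K (ω i) (ω j) ∂(Measure.pi fun _ : ι => μ)
      = I + if i = j then D - I else 0 := by
    intro i j
    split_ifs with hij
    · rw [hij, add_sub_cancel]
      exact integral_comp_eval (μ := fun _ : ι => μ) hdiag.aestronglyMeasurable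
    · rw [add_zero]
      exact integral_eval_pair hK hij
  rw [integral_finsetSum _ fun i _ => integrable_finsetSum _ fun j _ => hint i j]
  simp_rw [integral_finsetSum _ fun j _ => hint _ j, hentry, Finset.sum_add_distrib,
    Finset.sum_ite_eq, Finset.sum_const, Finset.mem_univ, if_true, Finset.sum_const,
    Finset.card_univ, nsmul_eq_mul]
  ring

end PairSums

namespace IsMercerKernel

section Pointwise

variable {𝒳 : Type*} {φ : 𝒳 → 𝒳 → ℝ}

theorem symm (hφ : IsMercerKernel φ) (u v : 𝒳) : φ u v = φ v u := by
  simpa using ((hφ 2 ![u, v]).isHermitian.apply 0 1).symm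

theorem diag_nonneg (hφ : IsMercerKernel φ) (u : 𝒳) : 0 ≤ φ u u := by
  simpa using (hφ 1 ![u]).diag_nonneg (i := 0)

theorem sq_le (hφ : IsMercerKernel φ) (u v : 𝒳) : φ u v ^ 2 ≤ φ u u * φ v v := by
  have hdet := (hφ 2 ![u, v]).det_nonneg
  rw [Matrix.det_fin_two] at hdet
  simp only [Matrix.of_apply, Matrix.cons_val_zero, Matrix.cons_val_one, hφ.symm v u] at hdet
  linarith

theorem abs_le (hφ : IsMercerKernel φ) (u v : 𝒳) : |φ u v| ≤ √(φ u u) * √(φ v v) := by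
  rw [← Real.sqrt_mul (hφ.diag_nonneg u)]
  exact Real.abs_le_sqrt (hφ.sq_le u v)

theorem sum_sum_nonneg (hφ : IsMercerKernel φ) {m : ℕ} (x : Fin m → 𝒳) (c : Fin m → ℝ) :
    0 ≤ ∑ i, ∑ j, φ (x i) (x j) * c i * c j := by
  refine ((hφ m x).dotProduct_mulVec_nonneg c).trans_eq ?_
  simp only [dotProduct, Matrix.mulVec, Matrix.of_apply, Finset.mul_sum, Pi.star_apply,
    star_trivial]
  exact Finset.sum_congr rfl fun i _ => Finset.sum_congr rfl fun j _ => by ring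

end Pointwise

section Rigidity

variable {Ω : Type*} [MeasurableSpace Ω] {μ : Measure Ω} [IsProbabilityMeasure μ] {φ : Ω → Ω → ℝ}
  {k : Ω → ℝ}

/- The average of the Gram form over `m` independent points is `m D + m (m - 1) I`, with `D` the
integral over the diagonal and `I` the one over the product; letting `m → ∞` gives `0 ≤ I`. -/
theorem integral_mul_mul_nonneg (hφ : IsMercerKernel φ) {h : Ω → ℝ}
    (hdiag : Integrable (fun u => φ u u * h u * h u) μ)
    (hprod : Integrable (Function.uncurry fun u y => φ u y * h u * h y) (μ.prod μ)) :
    0 ≤ ∫ z, φ z.1 z.2 * h z.1 * h z.2 ∂(μ.prod μ) := by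
  set D := ∫ u, φ u u * h u * h u ∂μ
  set I := ∫ z, φ z.1 z.2 * h z.1 * h z.2 ∂(μ.prod μ)
  have hgram : ∀ m : ℕ, 0 ≤ m * D + m * (m - 1) * I := fun m => by
    have hsum := integral_sum_sum_eval (ι := Fin m) hdiag hprod
    rw [Fintype.card_fin] at hsum
    rw [← hsum]
    exact integral_nonneg fun ω => hφ.sum_sum_nonneg ω fun i => h (ω i)
  by_contra! hI
  obtain ⟨m, hm⟩ := exists_nat_gt (max 0 (D / -I + 1))
  obtain ⟨hm₀, hm₁⟩ := max_lt_iff.1 hm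
  rw [← lt_sub_iff_add_lt, div_lt_iff₀ (neg_pos.2 hI)] at hm₁
  nlinarith [hgram m]

theorem integrable_left_of_integrable_diag (hφ : IsMercerKernel φ)
    (hm : Measurable (Function.uncurry φ)) (hdiag : Integrable (fun u => φ u u) μ) (v : Ω) :
    Integrable (fun u => φ v u) μ := by
  refine ((hdiag.add (integrable_const 1)).const_mul √(φ v v)).mono'
    (hm.comp measurable_prodMk_left).aestronglyMeasurable (Eventually.of_forall fun u => ?_)
  refine (hφ.abs_le v u).trans ?_
  gcongr
  refine Real.sqrt_le_iff.2 ⟨add_nonneg (hφ.diag_nonneg u) zero_le_one, ?_⟩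
  dsimp only [Pi.add_apply]
  nlinarith [hφ.diag_nonneg u]

theorem integral_mul_mul_integral_nonneg_of_ae_add (hφ : IsMercerKernel φ)
    (hdiag : Integrable (fun u => φ u u) μ) (hk : Integrable k μ)
    (hφk : ∀ᵐ z ∂(μ.prod μ), φ z.1 z.2 = k z.1 + k z.2) {h : Ω → ℝ} {C : ℝ} (hm : Measurable h)
    (hC : ∀ u, |h u| ≤ C) : 0 ≤ (∫ u, k u * h u ∂μ) * ∫ u, h u ∂μ := by
  have hbdd : ∀ {g : Ω → ℝ}, Integrable g μ → Integrable (fun u => g u * h u) μ := fun hg =>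
    hg.mul_bdd (c := C) hm.aestronglyMeasurable (Eventually.of_forall hC)
  have hh : Integrable h μ := by simpa using hbdd (integrable_const 1)
  have hleft := (hbdd hk).mul_prod hh
  have hright := hh.mul_prod (hbdd hk)
  have hae : (fun z : Ω × Ω => φ z.1 z.2 * h z.1 * h z.2)
      =ᵐ[μ.prod μ] fun z => k z.1 * h z.1 * h z.2 + h z.1 * (k z.2 * h z.2) := by
    filter_upwards [hφk] with z hz
    rw [hz]
    ring
  have hnonneg := hφ.integral_mul_mul_nonneg (hbdd (hbdd hdiag))
    ((hleft.add hright).congr hae.symm)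
  rw [integral_congr_ae hae, integral_add hleft hright,
    integral_prod_mul (fun u => k u * h u) h, integral_prod_mul h fun u => k u * h u] at hnonneg
  linarith [mul_comm (∫ u, h u ∂μ) (∫ u, k u * h u ∂μ)]

/- A kernel `k(u) + k(y)` is indefinite in the directions `h + ε`, `|ε|` small, unless `k ⊥ h`. -/
theorem integral_mul_eq_zero_of_ae_add (hφ : IsMercerKernel φ)
    (hdiag : Integrable (fun u => φ u u) μ) (hk : Integrable k μ)
    (hφk : ∀ᵐ z ∂(μ.prod μ), φ z.1 z.2 = k z.1 + k z.2) {h : Ω → ℝ} {C : ℝ} (hm : Measurable h)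
    (hC : ∀ u, |h u| ≤ C) (hmean : ∫ u, h u ∂μ = 0) : ∫ u, k u * h u ∂μ = 0 := by
  have hkh : Integrable (fun u => k u * h u) μ :=
    hk.mul_bdd (c := C) hm.aestronglyMeasurable (Eventually.of_forall hC)
  have hh : Integrable h μ :=
    (integrable_const C).mono' hm.aestronglyMeasurable (Eventually.of_forall hC)
  have htest : ∀ ε : ℝ,
      0 ≤ (∫ u, k u ∂μ) * (ε * ε) + (∫ u, k u * h u ∂μ) * ε + 0 := fun ε => by
    have hnonneg := hφ.integral_mul_mul_integral_nonneg_of_ae_add hdiag hk hφk (hm.add_const ε)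
      fun u => (abs_add_le _ _).trans (add_le_add_left (hC u) |ε|)
    simp only [mul_add] at hnonneg
    rw [integral_add hkh (hk.mul_const ε), integral_add hh (integrable_const ε),
      integral_mul_const, hmean, integral_const, probReal_univ, one_smul, zero_add] at hnonneg
    linarith
  have hdiscrim := discrim_le_zero htest
  rw [discrim, mul_zero, sub_zero] at hdiscrim
  exact pow_eq_zero_iff two_ne_zero |>.1 (le_antisymm hdiscrim (sq_nonneg _))

theorem ae_eq_integral_of_ae_add (hφ : IsMercerKernel φ) (hdiag : Integrable (fun u => φ u u) μ)
    (hk : Integrable k μ) (hφk : ∀ᵐ z ∂(μ.prod μ), φ z.1 z.2 = k z.1 + k z.2) :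
    k =ᵐ[μ] fun _ => ∫ u, k u ∂μ := by
  refine hk.ae_eq_of_forall_setIntegral_eq _ _ (integrable_const _) fun A hA _ => ?_
  have hA_int : Integrable (A.indicator (1 : Ω → ℝ)) μ := (integrable_const 1).indicator hA
  have hzero := hφ.integral_mul_eq_zero_of_ae_add hdiag hk hφk
    (h := fun u => A.indicator 1 u - μ.real A) (C := 1 + |μ.real A|)
    ((measurable_one.indicator hA).sub_const _)
    (fun u => (abs_sub _ _).trans <| by
      gcongr
      by_cases hu : u ∈ A <;> simp [hu])
    (by rw [integral_sub hA_int (integrable_const _), integral_indicator_one hA]; simp)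
  have hkA : ∀ u, k u * (A.indicator 1 u - μ.real A) = A.indicator k u - k u * μ.real A :=
    fun u => by by_cases hu : u ∈ A <;> simp [hu, mul_sub]
  rw [integral_congr_ae (Eventually.of_forall hkA),
    integral_sub (hk.indicator hA) (hk.mul_const _), integral_indicator hA,
    integral_mul_const] at hzero
  rw [setIntegral_const, smul_eq_mul]
  linarith

theorem exists_ae_eq_const_of_ae_eq_add (hφ : IsMercerKernel φ)
    (hm : Measurable (Function.uncurry φ)) (hdiag : Integrable (fun u => φ u u) μ) {a d : Ω → ℝ}
    (hsplit : ∀ᵐ z ∂(μ.prod μ), φ z.1 z.2 = a z.1 + d z.2) :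
    ∃ H : ℝ, ∀ᵐ z ∂(μ.prod μ), φ z.1 z.2 = H := by
  have hswap := Measure.measurePreserving_swap.quasiMeasurePreserving.ae hsplit
  obtain ⟨u₀, hd, ha⟩ := ((Measure.ae_ae_of_ae_prod hsplit).and
    (Measure.ae_ae_of_ae_prod hswap)).exists
  set k : Ω → ℝ := fun u => φ u₀ u - (a u₀ + d u₀) / 2
  have hφk : ∀ᵐ z ∂(μ.prod μ), φ z.1 z.2 = k z.1 + k z.2 := by
    filter_upwards [hsplit, Measure.quasiMeasurePreserving_fst.ae ha,
      Measure.quasiMeasurePreserving_snd.ae hd] with z hz hz₁ hz₂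
    simp only [Prod.fst_swap, Prod.snd_swap, hφ.symm z.1 u₀] at hz₁
    simp only [k, hz, hz₁, hz₂]
    ring
  have hk_int : Integrable k μ :=
    (hφ.integrable_left_of_integrable_diag hm hdiag u₀).sub (integrable_const _)
  have hk := hφ.ae_eq_integral_of_ae_add hdiag hk_int hφk
  refine ⟨2 * ∫ u, k u ∂μ, ?_⟩
  filter_upwards [hφk, Measure.quasiMeasurePreserving_fst.ae hk,
    Measure.quasiMeasurePreserving_snd.ae hk] with z hz hz₁ hz₂
  rw [hz, hz₁, hz₂, two_mul]

end Rigidity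

end IsMercerKernel

section ConditionalModel

variable {𝒳 : Type*} [MeasurableSpace 𝒳] {ν : Measure 𝒳} {f : 𝒳 → ℝ} {φ : 𝒳 → 𝒳 → ℝ} {p n : ℕ}
  {s : Fin p}

/-- A Mercer kernel `φ`, a potential `f` and a reference measure `ν` for which every conditional
law of the graphical model is normalizable: by the Cauchy–Schwarz inequality for `φ`, the
interaction of `u` with finitely many fixed points is `O(√(φ u u))`. -/
structure KernelModel (ν : Measure 𝒳) (f : 𝒳 → ℝ) (φ : 𝒳 → 𝒳 → ℝ) : Prop where
  measurable_kernel : Measurable (Function.uncurry φ)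
  measurable_potential : Measurable f
  mercer : IsMercerKernel φ
  integrable_exp (a : ℝ) : Integrable (fun u => Real.exp (f u + a * √(φ u u))) ν

/-- The vector `(φ(u, xₜ))_{t ≠ s}` of sufficient statistics of the conditional law of node `s`. -/
def feature (φ : 𝒳 → 𝒳 → ℝ) (s : Fin p) (x : Fin p → 𝒳) (u : 𝒳) : NodeParam s :=
  WithLp.toLp 2 fun t => φ u (x t)

/-- The law of `Xₛ` given that the other coordinates are those of `x`. -/
def condLaw (ν : Measure 𝒳) (f : 𝒳 → ℝ) (φ : 𝒳 → 𝒳 → ℝ) (θs : NodeParam s) (x : Fin p → 𝒳) :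
    Measure 𝒳 :=
  ν.tilted fun u => nodeExponent f φ θs u x

/-- The conditional mean of the sufficient statistics of node `s`. -/
def condMean (ν : Measure 𝒳) (f : 𝒳 → ℝ) (φ : 𝒳 → 𝒳 → ℝ) (θs : NodeParam s) (x : Fin p → 𝒳) :
    NodeParam s :=
  ∫ u, feature φ s x u ∂(condLaw ν f φ θs x)

/-- The sufficient statistics of node `s`, centred at their conditional mean. -/
def centredFeature (ν : Measure 𝒳) (f : 𝒳 → ℝ) (φ : 𝒳 → 𝒳 → ℝ) (θs : NodeParam s)
    (x : Fin p → 𝒳) (u : 𝒳) : NodeParam s :=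
  feature φ s x u - condMean ν f φ θs x

/-- The damped conditional variance of the sufficient statistics of node `s`, as a quadratic form;
it minorizes the Hessian of the conditional log-partition function near `θs`. -/
def curvature (ν : Measure 𝒳) (f : 𝒳 → ℝ) (φ : 𝒳 → 𝒳 → ℝ) (θs : NodeParam s) (x : Fin p → 𝒳)
    (Δ : NodeParam s) : ℝ :=
  dampedSecondMoment (condLaw ν f φ θs x) (centredFeature ν f φ θs x) Δ

/-- The gradient of the node-wise loss, minus the average score of the sample. -/
def nodeGrad (ν : Measure 𝒳) (f : 𝒳 → ℝ) (φ : 𝒳 → 𝒳 → ℝ) (X : Fin n → Fin p → 𝒳)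
    (θs : NodeParam s) : NodeParam s :=
  -(1 / (n : ℝ)) • ∑ i, centredFeature ν f φ θs (X i) (X i s)

omit [MeasurableSpace 𝒳] in
theorem nodeExponent_eq_add_inner (θs : NodeParam s) (u : 𝒳) (x : Fin p → 𝒳) :
    nodeExponent f φ θs u x = f u + ⟪θs, feature φ s x u⟫ := by
  simp [nodeExponent, feature, PiLp.inner_apply, mul_comm]

omit [MeasurableSpace 𝒳] in
theorem norm_feature_le (hφ : IsMercerKernel φ) (x : Fin p → 𝒳) (u : 𝒳) :
    ‖feature φ s x u‖ ≤ √(∑ t : {t : Fin p // t ≠ s}, φ (x t) (x t)) * √(φ u u) := by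
  rw [EuclideanSpace.norm_eq, ← Real.sqrt_mul (Finset.sum_nonneg fun t _ => hφ.diag_nonneg _),
    Finset.sum_mul]
  refine Real.sqrt_le_sqrt (Finset.sum_le_sum fun t _ => ?_)
  calc ‖feature φ s x u t‖ ^ 2 = φ u (x t) ^ 2 := by simp [feature]
    _ ≤ φ u u * φ (x t) (x t) := hφ.sq_le u (x t)
    _ = φ (x t) (x t) * φ u u := mul_comm _ _

theorem measurable_feature (hm : Measurable (Function.uncurry φ)) :
    Measurable fun z : (Fin p → 𝒳) × 𝒳 => feature φ s z.1 z.2 := by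
  refine (WithLp.measurable_toLp 2 _).comp (measurable_pi_iff.2 fun t => ?_)
  have hpair : Measurable fun z : (Fin p → 𝒳) × 𝒳 => (z.2, z.1 t) := by fun_prop
  exact hm.comp hpair

namespace KernelModel

variable (M : KernelModel ν f φ)
include M

theorem measurable_nodeExponent (θs : NodeParam s) :
    Measurable fun z : (Fin p → 𝒳) × 𝒳 => nodeExponent f φ θs z.2 z.1 := by
  simp_rw [nodeExponent_eq_add_inner]
  exact (M.measurable_potential.comp measurable_snd).add
    (measurable_feature M.measurable_kernel).const_inner

theorem measurable_feature_right (x : Fin p → 𝒳) : Measurable (feature φ s x) :=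
  (measurable_feature M.measurable_kernel).comp measurable_prodMk_left

theorem integrable_exp_nodeExponent_add_mul_norm (θs : NodeParam s) (x : Fin p → 𝒳) (a : ℝ) :
    Integrable (fun u => Real.exp (nodeExponent f φ θs u x + a * ‖feature φ s x u‖)) ν := by
  have hexponent : Measurable fun u => nodeExponent f φ θs u x :=
    (M.measurable_nodeExponent θs).comp measurable_prodMk_left
  have hfeature := M.measurable_feature_right (s := s) x
  refine (M.integrable_exp ((‖θs‖ + |a|) * √(∑ t : {t : Fin p // t ≠ s}, φ (x t) (x t)))).mono'
    (by fun_prop) (Eventually.of_forall fun u => ?_)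
  rw [Real.norm_eq_abs, Real.abs_exp, Real.exp_le_exp, nodeExponent_eq_add_inner, add_assoc]
  gcongr
  calc ⟪θs, feature φ s x u⟫ + a * ‖feature φ s x u‖
      ≤ ‖θs‖ * ‖feature φ s x u‖ + |a| * ‖feature φ s x u‖ := by
        gcongr
        · exact real_inner_le_norm _ _
        · exact le_abs_self a
    _ = (‖θs‖ + |a|) * ‖feature φ s x u‖ := by ring
    _ ≤ (‖θs‖ + |a|) * (√(∑ t : {t : Fin p // t ≠ s}, φ (x t) (x t)) * √(φ u u)) := by
        gcongr
        exact norm_feature_le M.mercer x u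
    _ = _ := (mul_assoc _ _ _).symm

theorem integrable_exp_nodeExponent (θs : NodeParam s) (x : Fin p → 𝒳) :
    Integrable (fun u => Real.exp (nodeExponent f φ θs u x)) ν := by
  simpa using M.integrable_exp_nodeExponent_add_mul_norm θs x 0

theorem hasExpMoments_feature (θs : NodeParam s) (x : Fin p → 𝒳) :
    HasExpMoments (condLaw ν f φ θs x) (feature φ s x) where
  aestronglyMeasurable := (M.measurable_feature_right x).aestronglyMeasurable
  integrable_exp_mul_norm a := by
    rw [condLaw, integrable_tilted_iff (M.integrable_exp_nodeExponent θs x)]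
    simpa only [smul_eq_mul, ← Real.exp_add] using
      M.integrable_exp_nodeExponent_add_mul_norm θs x a

theorem hasExpMoments_centredFeature (θs : NodeParam s) (x : Fin p → 𝒳) :
    HasExpMoments (condLaw ν f φ θs x) (centredFeature ν f φ θs x) :=
  (M.hasExpMoments_feature θs x).sub_const _

variable [NeZero ν]

theorem isProbabilityMeasure_condLaw (θs : NodeParam s) (x : Fin p → 𝒳) :
    IsProbabilityMeasure (condLaw ν f φ θs x) :=
  isProbabilityMeasure_tilted (M.integrable_exp_nodeExponent θs x)

theorem integral_centredFeature (θs : NodeParam s) (x : Fin p → 𝒳) :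
    ∫ u, centredFeature ν f φ θs x u ∂(condLaw ν f φ θs x) = 0 := by
  have := M.isProbabilityMeasure_condLaw θs x
  simp only [centredFeature]
  rw [integral_sub (M.hasExpMoments_feature θs x).integrable (integrable_const _)]
  simp [condMean]

theorem logMGF_feature (θs Δ : NodeParam s) (x : Fin p → 𝒳) :
    logMGF (condLaw ν f φ θs x) (feature φ s x) Δ
      = nodeLogPartition ν f φ (θs + Δ) x - nodeLogPartition ν f φ θs x := by
  have hshift : ∀ u, nodeExponent f φ θs u x + ⟪Δ, feature φ s x u⟫
      = nodeExponent f φ (θs + Δ) u x := fun u => by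
    rw [nodeExponent_eq_add_inner, nodeExponent_eq_add_inner, inner_add_left, add_assoc]
  rw [logMGF, condLaw, integral_exp_tilted]
  simp only [Pi.add_apply, hshift]
  exact Real.log_div (integral_exp_pos (M.integrable_exp_nodeExponent _ x)).ne'
    (integral_exp_pos (M.integrable_exp_nodeExponent _ x)).ne'

theorem logMGF_centredFeature (θs Δ : NodeParam s) (x : Fin p → 𝒳) :
    logMGF (condLaw ν f φ θs x) (centredFeature ν f φ θs x) Δ
      = nodeLogPartition ν f φ (θs + Δ) x - nodeLogPartition ν f φ θs x
        - ⟪Δ, condMean ν f φ θs x⟫ := by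
  have := M.isProbabilityMeasure_condLaw θs x
  rw [← M.logMGF_feature, ← logMGF_sub_const (M.hasExpMoments_feature θs x)]
  rfl

theorem bregmanRemainder_nodeLoss (X : Fin n → Fin p → 𝒳) (θs Δ : NodeParam s) :
    bregmanRemainder (nodeLoss ν f φ X) (nodeGrad ν f φ X θs) θs Δ
      = 1 / (n : ℝ) * ∑ i, logMGF (condLaw ν f φ θs (X i)) (centredFeature ν f φ θs (X i)) Δ := by
  have hsample : ∀ i, logMGF (condLaw ν f φ θs (X i)) (centredFeature ν f φ θs (X i)) Δ
      = (nodeExponent f φ θs (X i s) (X i) - nodeLogPartition ν f φ θs (X i))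
        - (nodeExponent f φ (θs + Δ) (X i s) (X i) - nodeLogPartition ν f φ (θs + Δ) (X i))
        + ⟪centredFeature ν f φ θs (X i) (X i s), Δ⟫ := fun i => by
    rw [M.logMGF_centredFeature, nodeExponent_eq_add_inner, nodeExponent_eq_add_inner,
      inner_add_left, real_inner_comm Δ (centredFeature ν f φ θs (X i) (X i s)), centredFeature,
      inner_sub_right]
    ring
  simp only [bregmanRemainder, nodeLoss, nodeDensity, Real.log_exp, nodeGrad,
    real_inner_smul_left, sum_inner, hsample, Finset.sum_add_distrib, Finset.sum_sub_distrib]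
  ring

theorem eighth_curvature_le_logMGF (θs : NodeParam s) (x : Fin p → 𝒳) {Δ : NodeParam s}
    (hΔ : ‖Δ‖ ≤ 1) :
    1 / 8 * curvature ν f φ θs x Δ
      ≤ logMGF (condLaw ν f φ θs x) (centredFeature ν f φ θs x) Δ :=
  have := M.isProbabilityMeasure_condLaw θs x
  eighth_dampedSecondMoment_le_logMGF (M.hasExpMoments_centredFeature θs x)
    (M.integral_centredFeature θs x) hΔ

theorem hasGradientAt_nodeLoss (X : Fin n → Fin p → 𝒳) (θs : NodeParam s) :
    HasGradientAt (nodeLoss ν f φ X) (nodeGrad ν f φ X θs) θs := by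
  refine hasGradientAt_of_abs_bregmanRemainder_le (C := 1 / (n : ℝ) * ∑ i, ∫ u,
    ‖centredFeature ν f φ θs (X i) u‖ ^ 2 * Real.exp ‖centredFeature ν f φ θs (X i) u‖
      ∂(condLaw ν f φ θs (X i))) fun Δ hΔ => ?_
  have hP := fun i => M.isProbabilityMeasure_condLaw θs (X i)
  have hnonneg : ∀ i, 0 ≤ logMGF (condLaw ν f φ θs (X i)) (centredFeature ν f φ θs (X i)) Δ :=
    fun i => (mul_nonneg (by norm_num) dampedSecondMoment_nonneg).trans
      (M.eighth_curvature_le_logMGF θs (X i) hΔ)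
  rw [M.bregmanRemainder_nodeLoss,
    abs_of_nonneg (mul_nonneg (by positivity) (Finset.sum_nonneg fun i _ => hnonneg i)),
    mul_assoc, Finset.sum_mul]
  gcongr with i
  exact logMGF_le_mul_norm_sq (M.hasExpMoments_centredFeature θs _)
    (M.integral_centredFeature θs _) hΔ

theorem continuous_nodeLoss (X : Fin n → Fin p → 𝒳) :
    Continuous (nodeLoss ν f φ X : NodeParam s → ℝ) :=
  continuous_iff_continuousAt.2 fun θs => (M.hasGradientAt_nodeLoss X θs).continuousAt

theorem nodeGradSup_eq (X : Fin n → Fin p → 𝒳) (θs : NodeParam s) :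
    nodeGradSup ν f φ X θs = ⨆ t, |nodeGrad ν f φ X θs t| := by
  rw [nodeGradSup, (M.hasGradientAt_nodeLoss X θs).gradient]

theorem hasLocalCurvature_nodeLoss (X : Fin n → Fin p → 𝒳) (θs : NodeParam s) {m : ℝ}
    (hcurv : ∀ Δ, m * ‖Δ‖ ^ 2 ≤ 1 / (n : ℝ) * ∑ i, curvature ν f φ θs (X i) Δ) :
    HasLocalCurvature (bregmanRemainder (nodeLoss ν f φ X) (nodeGrad ν f φ X θs) θs) (m / 8) where
  mul_norm_sq_le Δ hΔ := by
    rw [M.bregmanRemainder_nodeLoss]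
    calc m / 8 * ‖Δ‖ ^ 2 = 1 / 8 * (m * ‖Δ‖ ^ 2) := by ring
      _ ≤ 1 / 8 * (1 / (n : ℝ) * ∑ i, curvature ν f φ θs (X i) Δ) :=
        mul_le_mul_of_nonneg_left (hcurv Δ) (by norm_num)
      _ = 1 / (n : ℝ) * ∑ i, 1 / 8 * curvature ν f φ θs (X i) Δ := by
        rw [mul_left_comm, Finset.mul_sum]
      _ ≤ _ := by gcongr with i; exact M.eighth_curvature_le_logMGF θs (X i) hΔ
  mul_le_smul Δ τ hτ := by
    have hP := fun i => M.isProbabilityMeasure_condLaw θs (X i)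
    rw [M.bregmanRemainder_nodeLoss, M.bregmanRemainder_nodeLoss, mul_left_comm, Finset.mul_sum]
    gcongr with i
    exact mul_logMGF_le_logMGF_smul (M.hasExpMoments_centredFeature θs _) Δ hτ

theorem nodeEstimators_error (X : Fin n → Fin p → 𝒳) (θs : NodeParam s) {m lam : ℝ}
    (hcurv : ∀ Δ, m * ‖Δ‖ ^ 2 ≤ 1 / (n : ℝ) * ∑ i, curvature ν f φ θs (X i) Δ)
    (hlam : 2 * nodeGradSup ν f φ X θs ≤ lam) (hsmall : 12 * lam * √(l0Norm θs : ℝ) < m) :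
    (nodeEstimators ν f φ s X lam).Nonempty ∧
      ∀ θhat ∈ nodeEstimators ν f φ s X lam, ‖θhat - θs‖ ≤ 12 * lam * √(l0Norm θs : ℝ) / m := by
  rw [M.nodeGradSup_eq] at hlam
  have hsup : 0 ≤ ⨆ t, |nodeGrad ν f φ X θs t| := Real.iSup_nonneg fun _ => abs_nonneg _
  have hgrad : ∀ t, |nodeGrad ν f φ X θs t| ≤ lam / 2 := fun t =>
    (le_ciSup (f := fun t => |nodeGrad ν f φ X θs t|) (Set.finite_range _).bddAbove t).trans
      (by linarith)
  have hR := M.hasLocalCurvature_nodeLoss X θs hcurv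
  have hsmall_eighth : 3 / 2 * lam * √({t | θs t ≠ 0}.ncard : ℝ) < m / 8 := by
    rw [l0Norm] at hsmall
    linarith
  refine ⟨exists_lassoObjective_le (by linarith) hgrad hR hsmall_eighth (M.continuous_nodeLoss X),
    fun θhat hθhat => (norm_sub_le_of_lassoObjective_le (by linarith) hgrad hR hsmall_eighth
      (hθhat θs)).trans_eq ?_⟩
  rw [l0Norm]
  ring

end KernelModel

end ConditionalModel

theorem lintegral_ofReal_exp_mul_lintegral_tilted {Ω : Type*} [MeasurableSpace Ω] {μ : Measure Ω}
    [NeZero μ] {g : Ω → ℝ} (hg : Integrable (fun ω => Real.exp (g ω)) μ) (F : Ω → ℝ≥0∞) {c : ℝ}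
    (hc : 0 ≤ c) :
    ∫⁻ ω, ENNReal.ofReal (Real.exp (g ω) / c) * ∫⁻ ω', F ω' ∂(μ.tilted g) ∂μ
      = ∫⁻ ω, ENNReal.ofReal (Real.exp (g ω) / c) * F ω ∂μ := by
  have hZ := integral_exp_pos hg
  have hZ_lintegral := ofReal_integral_eq_lintegral_ofReal hg
    (Eventually.of_forall fun ω => (Real.exp_pos _).le)
  rw [lintegral_tilted]
  simp only [div_eq_inv_mul, ENNReal.ofReal_mul (inv_nonneg.2 hc),
    ENNReal.ofReal_mul (inv_nonneg.2 hZ.le), mul_assoc]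
  rw [lintegral_const_mul' _ _ ENNReal.ofReal_ne_top, lintegral_const_mul' _ _
    ENNReal.ofReal_ne_top, lintegral_mul_const'' _ hg.aemeasurable.ennreal_ofReal, ← hZ_lintegral,
    lintegral_const_mul' _ _ ENNReal.ofReal_ne_top, ENNReal.ofReal_inv_of_pos hZ,
    ENNReal.mul_inv_cancel_left (ENNReal.ofReal_pos.2 hZ).ne' ENNReal.ofReal_ne_top]

theorem memLp_two_integral_compProd {Ω Ω' : Type*} [MeasurableSpace Ω] [MeasurableSpace Ω']
    {μ : Measure Ω} [IsFiniteMeasure μ] {κ : Kernel Ω Ω'} [IsMarkovKernel κ] {F : Ω → Ω' → ℝ}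
    (hF : MemLp (Function.uncurry F) 2 (μ ⊗ₘ κ)) : MemLp (fun x => ∫ u, F x u ∂(κ x)) 2 μ := by
  have hmean : AEStronglyMeasurable (fun x => ∫ u, F x u ∂(κ x)) μ :=
    (hF.integrable one_le_two).integral_compProd.aestronglyMeasurable
  have hsq : Integrable (fun z => F z.1 z.2 ^ 2) (μ ⊗ₘ κ) := hF.integrable_sq
  have hmean_sq : Integrable (fun x => ∫ u, F x u ^ 2 ∂(κ x)) μ := hsq.integral_compProd
  rw [memLp_two_iff_integrable_sq hmean]
  refine hmean_sq.mono' (hmean.pow 2) ?_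
  filter_upwards [hF.aestronglyMeasurable.ae_of_compProd,
    ((Measure.integrable_compProd_iff hsq.aestronglyMeasurable).1 hsq).1] with x hmeas hsection
  have hvar : variance (F x) (κ x) = ∫ u, F x u ^ 2 ∂(κ x) - (∫ u, F x u ∂(κ x)) ^ 2 :=
    variance_eq_sub ((memLp_two_iff_integrable_sq hmeas).2 hsection)
  rw [Real.norm_of_nonneg (sq_nonneg _)]
  linarith [variance_nonneg (F x) (κ x)]

section GibbsResampling

variable {ι : Type*} [DecidableEq ι] {S : ι → Type*} [∀ i, MeasurableSpace (S i)]
  {μ : ∀ i, Measure (S i)} [∀ i, SigmaFinite (μ i)] {E : (∀ i, S i) → ℝ} {i : ι}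

/-- The kernel that redraws coordinate `i` from its conditional law given the others, for the
Gibbs measure with density proportional to `exp E` with respect to the product of the `μ i`. -/
def gibbsKernel (μ : ∀ i, Measure (S i)) [∀ i, SigmaFinite (μ i)] (E : (∀ i, S i) → ℝ) (i : ι) :
    Kernel (∀ i, S i) (S i) :=
  (Kernel.const _ (μ i)).withDensity fun x u =>
    ENNReal.ofReal (Real.exp (E (Function.update x i u))
      / ∫ v, Real.exp (E (Function.update x i v)) ∂(μ i))

variable (hE : Measurable E)
include hE

theorem measurable_gibbsDensity (i : ι) :
    Measurable fun z : (∀ i, S i) × S i =>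
      ENNReal.ofReal (Real.exp (E (Function.update z.1 i z.2))
        / ∫ v, Real.exp (E (Function.update z.1 i v)) ∂(μ i)) := by
  have hexp : Measurable fun z : (∀ i, S i) × S i => Real.exp (E (Function.update z.1 i z.2)) := by
    fun_prop
  exact (hexp.div ((hexp.stronglyMeasurable.integral_prod_right' (ν := μ i)).measurable.comp
    measurable_fst)).ennreal_ofReal

theorem gibbsKernel_apply (x : ∀ i, S i) :
    gibbsKernel μ E i x = (μ i).tilted fun u => E (Function.update x i u) := by
  rw [gibbsKernel, Kernel.withDensity_apply _ (measurable_gibbsDensity hE i), Kernel.const_apply]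
  rfl

variable [NeZero (μ i)]
  (hfibre : ∀ x, Integrable (fun u => Real.exp (E (Function.update x i u))) (μ i))
include hfibre

theorem isMarkovKernel_gibbsKernel : IsMarkovKernel (gibbsKernel μ E i) :=
  ⟨fun x => by rw [gibbsKernel_apply hE]; exact isProbabilityMeasure_tilted (hfibre x)⟩

variable [Fintype ι]

theorem lintegral_lintegral_gibbsKernel {F : (∀ i, S i) → ℝ≥0∞} (hF : Measurable F) :
    ∫⁻ x, ∫⁻ u, F (Function.update x i u) ∂(gibbsKernel μ E i x) ∂((Measure.pi μ).tilted E)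
      = ∫⁻ x, F x ∂((Measure.pi μ).tilted E) := by
  have := isMarkovKernel_gibbsKernel hE hfibre
  have hF_update : Measurable fun z : (∀ i, S i) × S i => F (Function.update z.1 i z.2) := by
    fun_prop
  have hresample := hF_update.lintegral_kernel_prod_right' (κ := gibbsKernel μ E i)
  rw [lintegral_tilted, lintegral_tilted]
  refine lintegral_eq_of_lmarginal_eq {i} (.mul (by fun_prop) hresample) (by fun_prop) ?_
  simp only [lmarginal_singleton, gibbsKernel_apply hE, Function.update_idem]
  exact funext fun x => lintegral_ofReal_exp_mul_lintegral_tilted (hfibre x) _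
    (integral_nonneg fun _ => (Real.exp_pos _).le)

theorem map_update_compProd_gibbsKernel :
    ((Measure.pi μ).tilted E ⊗ₘ gibbsKernel μ E i).map (fun z => Function.update z.1 i z.2)
      = (Measure.pi μ).tilted E := by
  have := isMarkovKernel_gibbsKernel hE hfibre
  have hupdate : Measurable fun z : (∀ i, S i) × S i => Function.update z.1 i z.2 := by fun_prop
  refine Measure.ext_of_lintegral _ fun F hF => ?_
  rw [lintegral_map hF hupdate, Measure.lintegral_compProd (by fun_prop)]
  exact lintegral_lintegral_gibbsKernel hE hfibre hF

theorem ae_ae_update_of_ae {q : (∀ i, S i) → Prop} (h : ∀ᵐ x ∂((Measure.pi μ).tilted E), q x) :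
    ∀ᵐ x ∂((Measure.pi μ).tilted E), ∀ᵐ u ∂(μ i), q (Function.update x i u) := by
  have := isMarkovKernel_gibbsKernel hE hfibre
  have hupdate : Measurable fun z : (∀ i, S i) × S i => Function.update z.1 i z.2 := by fun_prop
  rw [← map_update_compProd_gibbsKernel hE hfibre] at h
  filter_upwards [Measure.ae_ae_of_ae_compProd (ae_of_ae_map hupdate.aemeasurable h)] with x hx
  rw [gibbsKernel_apply hE] at hx
  exact (absolutelyContinuous_tilted (hfibre x)).ae_le hx

theorem ae_of_ae_ae_update {q : (∀ i, S i) → Prop} (hq : MeasurableSet {x | q x})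
    (h : ∀ᵐ x ∂((Measure.pi μ).tilted E), ∀ᵐ u ∂(μ i), q (Function.update x i u)) :
    ∀ᵐ x ∂((Measure.pi μ).tilted E), q x := by
  have := isMarkovKernel_gibbsKernel hE hfibre
  have hupdate : Measurable fun z : (∀ i, S i) × S i => Function.update z.1 i z.2 := by fun_prop
  rw [← map_update_compProd_gibbsKernel hE hfibre, ae_map_iff hupdate.aemeasurable hq]
  refine Measure.ae_compProd_of_ae_ae (hupdate hq) ?_
  filter_upwards [h] with x hx
  rw [gibbsKernel_apply hE]
  exact (tilted_absolutelyContinuous (μ i) _).ae_le hx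

theorem integrable_update_compProd_gibbsKernel {h : (∀ i, S i) → ℝ}
    (hint : Integrable h ((Measure.pi μ).tilted E)) :
    Integrable (fun z : (∀ i, S i) × S i => h (Function.update z.1 i z.2))
      ((Measure.pi μ).tilted E ⊗ₘ gibbsKernel μ E i) := by
  rw [← map_update_compProd_gibbsKernel hE hfibre] at hint
  exact hint.comp_measurable (by fun_prop)

theorem memLp_two_integral_gibbsKernel {h : (∀ i, S i) → ℝ}
    (hL2 : MemLp h 2 ((Measure.pi μ).tilted E)) :
    MemLp (fun x => ∫ u, h (Function.update x i u) ∂(gibbsKernel μ E i x)) 2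
      ((Measure.pi μ).tilted E) := by
  have := isMarkovKernel_gibbsKernel hE hfibre
  rw [← map_update_compProd_gibbsKernel hE hfibre] at hL2
  exact memLp_two_integral_compProd (F := fun x u => h (Function.update x i u))
    (hL2.comp_measurePreserving ⟨by fun_prop, rfl⟩)

theorem integral_integral_gibbsKernel {h : (∀ i, S i) → ℝ}
    (hint : Integrable h ((Measure.pi μ).tilted E)) :
    ∫ x, ∫ u, h (Function.update x i u) ∂(gibbsKernel μ E i x) ∂((Measure.pi μ).tilted E)
      = ∫ x, h x ∂((Measure.pi μ).tilted E) := by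
  have := isMarkovKernel_gibbsKernel hE hfibre
  have hupdate : Measurable fun z : (∀ i, S i) × S i => Function.update z.1 i z.2 := by fun_prop
  rw [← Measure.integral_compProd (integrable_update_compProd_gibbsKernel hE hfibre hint)]
  conv_rhs => rw [← map_update_compProd_gibbsKernel hE hfibre]
  refine (integral_map hupdate.aemeasurable ?_).symm
  rw [map_update_compProd_gibbsKernel hE hfibre]
  exact hint.aestronglyMeasurable

end GibbsResampling

section FullConditional

variable {𝒳 : Type*} {f : 𝒳 → ℝ} {φ : 𝒳 → 𝒳 → ℝ} {p : ℕ} {θ : Fin p → Fin p → ℝ} {s : Fin p}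

theorem sum_sum_Ioi_eq_add {F : Fin p → Fin p → ℝ} (hF : ∀ a b, F a b = F b a) (s : Fin p) :
    ∑ a, ∑ b ∈ Finset.Ioi a, F a b = ∑ t : {t : Fin p // t ≠ s}, F s t
      + ∑ a ∈ Finset.univ.erase s, ∑ b ∈ (Finset.Ioi a).erase s, F a b := by
  have hrow : ∀ a ∈ Finset.univ.erase s, ∑ b ∈ Finset.Ioi a, F a b
      = (if a < s then F s a else 0) + ∑ b ∈ (Finset.Ioi a).erase s, F a b := fun a _ => by
    split_ifs with has
    · rw [hF s a, Finset.add_sum_erase _ _ (Finset.mem_Ioi.2 has)]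
    · rw [Finset.erase_eq_of_notMem (by simpa using has), zero_add]
  have hcolumn : ∑ a ∈ Finset.univ.erase s, (if a < s then F s a else 0)
      = ∑ a ∈ Finset.Iio s, F s a := by
    rw [← Finset.sum_filter]
    congr 1
    ext a
    simpa using ne_of_lt
  have hneighbours : ∑ t : {t : Fin p // t ≠ s}, F s t
      = ∑ b ∈ Finset.Ioi s, F s b + ∑ a ∈ Finset.Iio s, F s a := by
    rw [← Finset.sum_disjUnion (Finset.disjoint_Ioi_Iio s), Finset.Ioi_disjUnion_Iio]
    exact (Finset.sum_subtype _ (by simp) _).symm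
  rw [← Finset.add_sum_erase _ _ (Finset.mem_univ s), Finset.sum_congr rfl hrow,
    Finset.sum_add_distrib, hcolumn, hneighbours, add_assoc]

/-- The part of the exponent that does not involve node `s`. -/
def restExponent (f : 𝒳 → ℝ) (φ : 𝒳 → 𝒳 → ℝ) (θ : Fin p → Fin p → ℝ) (s : Fin p)
    (x : Fin p → 𝒳) : ℝ :=
  ∑ a ∈ Finset.univ.erase s, f (x a)
    + ∑ a ∈ Finset.univ.erase s, ∑ b ∈ (Finset.Ioi a).erase s, θ a b * φ (x a) (x b)

theorem exponent_eq_nodeExponent_add (hφ : IsMercerKernel φ) (hθ : ∀ s t, θ s t = θ t s)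
    (s : Fin p) (x : Fin p → 𝒳) :
    exponent f φ θ x = nodeExponent f φ (nodeParam θ s) (x s) x + restExponent f φ θ s x := by
  rw [exponent, sum_sum_Ioi_eq_add (fun a b => by rw [hθ, hφ.symm]) s,
    ← Finset.add_sum_erase _ _ (Finset.mem_univ s), nodeExponent, restExponent]
  simp only [nodeParam]
  ring

theorem restExponent_update (x : Fin p → 𝒳) (u : 𝒳) :
    restExponent f φ θ s (Function.update x s u) = restExponent f φ θ s x := by
  have hupdate : ∀ a ≠ s, Function.update x s u a = x a := fun a ha => Function.update_of_ne ha _ _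
  refine congr_arg₂ (· + ·) (Finset.sum_congr rfl fun a ha => ?_)
    (Finset.sum_congr rfl fun a ha => Finset.sum_congr rfl fun b hb => ?_)
  · rw [hupdate a (Finset.ne_of_mem_erase ha)]
  · rw [hupdate a (Finset.ne_of_mem_erase ha), hupdate b (Finset.ne_of_mem_erase hb)]

theorem feature_update (x : Fin p → 𝒳) (v u : 𝒳) :
    feature φ s (Function.update x s v) u = feature φ s x u := by
  ext t
  simp [feature, Function.update_of_ne t.2]

theorem nodeExponent_update (θs : NodeParam s) (x : Fin p → 𝒳) (v u : 𝒳) :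
    nodeExponent f φ θs u (Function.update x s v) = nodeExponent f φ θs u x := by
  rw [nodeExponent_eq_add_inner, nodeExponent_eq_add_inner, feature_update]

theorem exponent_update (hφ : IsMercerKernel φ) (hθ : ∀ s t, θ s t = θ t s)
    (s : Fin p) (x : Fin p → 𝒳) (u : 𝒳) :
    exponent f φ θ (Function.update x s u)
      = nodeExponent f φ (nodeParam θ s) u x + restExponent f φ θ s x := by
  rw [exponent_eq_nodeExponent_add hφ hθ s, nodeExponent_update, restExponent_update,
    Function.update_self]

variable [MeasurableSpace 𝒳] {ν : Measure 𝒳}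

theorem tilted_add_const (g : 𝒳 → ℝ) (c : ℝ) : ν.tilted (fun u => g u + c) = ν.tilted g := by
  simp only [Measure.tilted, Real.exp_add, integral_mul_const,
    mul_div_mul_right _ _ (Real.exp_pos c).ne']

theorem neZero_pi [SigmaFinite ν] [NeZero ν] : NeZero (Measure.pi fun _ : Fin p => ν) := by
  rw [neZero_iff, ← Measure.measure_univ_ne_zero, Measure.pi_univ]
  exact Finset.prod_ne_zero_iff.2 fun _ _ => Measure.measure_univ_ne_zero.2 (NeZero.ne ν)

theorem jointLaw_eq_tilted [SigmaFinite ν] [NeZero ν] (hN : Normalizable ν f φ θ) :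
    jointLaw ν f φ θ = (Measure.pi fun _ => ν).tilted (exponent f φ θ) := by
  have := neZero_pi (ν := ν) (p := p)
  simp only [jointLaw, Measure.tilted, logPartition, Real.exp_sub,
    Real.exp_log (integral_exp_pos hN)]

theorem isProbabilityMeasure_jointLaw [SigmaFinite ν] [NeZero ν] (hN : Normalizable ν f φ θ) :
    IsProbabilityMeasure (jointLaw ν f φ θ) := by
  have := neZero_pi (ν := ν) (p := p)
  rw [jointLaw_eq_tilted hN]
  exact isProbabilityMeasure_tilted hN

namespace KernelModel

variable (M : KernelModel ν f φ)
include M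

theorem measurable_kernel_eval (a b : Fin p) :
    Measurable fun x : Fin p → 𝒳 => φ (x a) (x b) := by
  have hpair : Measurable fun x : Fin p → 𝒳 => (x a, x b) := by fun_prop
  exact M.measurable_kernel.comp hpair

theorem measurable_exponent (θ : Fin p → Fin p → ℝ) : Measurable (exponent f φ θ) := by
  have hf := M.measurable_potential
  refine Measurable.add (by fun_prop) (Finset.measurable_fun_sum _ fun a _ =>
    Finset.measurable_fun_sum _ fun b _ => (M.measurable_kernel_eval a b).const_mul _)

variable (hθ : ∀ s t, θ s t = θ t s)
include hθ

theorem integrable_exp_exponent_update (s : Fin p) (x : Fin p → 𝒳) :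
    Integrable (fun u => Real.exp (exponent f φ θ (Function.update x s u))) ν := by
  simpa only [exponent_update M.mercer hθ, Real.exp_add] using
    (M.integrable_exp_nodeExponent (nodeParam θ s) x).mul_const _

variable [SigmaFinite ν]

theorem gibbsKernel_exponent_apply (s : Fin p) (x : Fin p → 𝒳) :
    gibbsKernel (fun _ => ν) (exponent f φ θ) s x = condLaw ν f φ (nodeParam θ s) x := by
  simp only [gibbsKernel_apply (M.measurable_exponent θ), exponent_update M.mercer hθ,
    tilted_add_const, condLaw]

variable [NeZero ν] (hN : Normalizable ν f φ θ)
include hN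

theorem ae_ae_update_of_ae_jointLaw (s : Fin p) {q : (Fin p → 𝒳) → Prop}
    (h : ∀ᵐ x ∂(jointLaw ν f φ θ), q x) :
    ∀ᵐ x ∂(jointLaw ν f φ θ), ∀ᵐ u ∂ν, q (Function.update x s u) := by
  rw [jointLaw_eq_tilted hN] at h ⊢
  exact ae_ae_update_of_ae (M.measurable_exponent θ) (M.integrable_exp_exponent_update hθ s) h

theorem ae_jointLaw_of_ae_ae_update (s : Fin p) {q : (Fin p → 𝒳) → Prop}
    (hq : MeasurableSet {x | q x})
    (h : ∀ᵐ x ∂(jointLaw ν f φ θ), ∀ᵐ u ∂ν, q (Function.update x s u)) :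
    ∀ᵐ x ∂(jointLaw ν f φ θ), q x := by
  rw [jointLaw_eq_tilted hN] at h ⊢
  exact ae_of_ae_ae_update (M.measurable_exponent θ) (M.integrable_exp_exponent_update hθ s) hq h

theorem integral_integral_condLaw (s : Fin p) {h : (Fin p → 𝒳) → ℝ}
    (hint : Integrable h (jointLaw ν f φ θ)) :
    ∫ x, ∫ u, h (Function.update x s u) ∂(condLaw ν f φ (nodeParam θ s) x) ∂(jointLaw ν f φ θ)
      = ∫ x, h x ∂(jointLaw ν f φ θ) := by
  simp_rw [← M.gibbsKernel_exponent_apply hθ]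
  rw [jointLaw_eq_tilted hN] at hint ⊢
  exact integral_integral_gibbsKernel (M.measurable_exponent θ)
    (M.integrable_exp_exponent_update hθ s) hint

theorem memLp_two_integral_condLaw (s : Fin p) {h : (Fin p → 𝒳) → ℝ}
    (hL2 : MemLp h 2 (jointLaw ν f φ θ)) :
    MemLp (fun x => ∫ u, h (Function.update x s u) ∂(condLaw ν f φ (nodeParam θ s) x)) 2
      (jointLaw ν f φ θ) := by
  simp_rw [← M.gibbsKernel_exponent_apply hθ]
  rw [jointLaw_eq_tilted hN] at hL2 ⊢
  exact memLp_two_integral_gibbsKernel (M.measurable_exponent θ)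
    (M.integrable_exp_exponent_update hθ s) hL2

end KernelModel

end FullConditional

section DampedCrossMoment

variable {Ω ι : Type*} [MeasurableSpace Ω] [Fintype ι] {P : Measure Ω}
  {G : Ω → EuclideanSpace ℝ ι}

/-- The coefficients of the quadratic form `dampedSecondMoment P G`. -/
def dampedCrossMoment (P : Measure Ω) (G : Ω → EuclideanSpace ℝ ι) (j k : ι) : ℝ :=
  ∫ ω, G ω j * G ω k * Real.exp (-‖G ω‖) ∂P

theorem abs_mul_mul_exp_neg_norm_le_two (v : EuclideanSpace ℝ ι) (j k : ι) :
    |v j * v k * Real.exp (-‖v‖)| ≤ 2 := by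
  calc |v j * v k * Real.exp (-‖v‖)| = |v j| * |v k| * Real.exp (-‖v‖) := by
        rw [abs_mul, abs_mul, Real.abs_exp]
    _ ≤ ‖v‖ * ‖v‖ * Real.exp (-‖v‖) := by
        gcongr
        · exact PiLp.norm_apply_le v j
        · exact PiLp.norm_apply_le v k
    _ = ‖v‖ ^ 2 * Real.exp (-‖v‖) := by rw [sq]
    _ ≤ 2 := sq_mul_exp_neg_le_two (norm_nonneg v)

theorem abs_dampedCrossMoment_le_two [IsProbabilityMeasure P] (j k : ι) :
    |dampedCrossMoment P G j k| ≤ 2 := by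
  have hbound := norm_integral_le_of_norm_le_const (μ := P) (C := 2)
    (f := fun ω => G ω j * G ω k * Real.exp (-‖G ω‖))
    (Eventually.of_forall fun ω => abs_mul_mul_exp_neg_norm_le_two (G ω) j k)
  simpa [dampedCrossMoment] using hbound

theorem inner_sq_mul_exp_neg_norm_eq_sum (Δ v : EuclideanSpace ℝ ι) :
    ⟪Δ, v⟫ ^ 2 * Real.exp (-‖v‖) = ∑ j, ∑ k, Δ j * Δ k * (v j * v k * Real.exp (-‖v‖)) := by
  have hinner : ⟪Δ, v⟫ = ∑ j, Δ j * v j := by simp [PiLp.inner_apply, mul_comm]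
  rw [hinner, sq, Finset.sum_mul_sum, Finset.sum_mul]
  refine Finset.sum_congr rfl fun j _ => ?_
  rw [Finset.sum_mul]
  exact Finset.sum_congr rfl fun k _ => by ring

theorem dampedSecondMoment_eq_sum [IsFiniteMeasure P] (hG : AEStronglyMeasurable G P)
    (Δ : EuclideanSpace ℝ ι) :
    dampedSecondMoment P G Δ = ∑ j, ∑ k, Δ j * Δ k * dampedCrossMoment P G j k := by
  have hint : ∀ j k, Integrable (fun ω => Δ j * Δ k * (G ω j * G ω k * Real.exp (-‖G ω‖))) P :=
    fun j k => Integrable.const_mul ((integrable_const (2 : ℝ)).mono'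
      ((by fun_prop : Continuous fun v : EuclideanSpace ℝ ι =>
        v j * v k * Real.exp (-‖v‖)).comp_aestronglyMeasurable hG)
      (Eventually.of_forall fun ω => abs_mul_mul_exp_neg_norm_le_two (G ω) j k)) _
  simp only [dampedSecondMoment, dampedCrossMoment, inner_sq_mul_exp_neg_norm_eq_sum]
  rw [integral_finsetSum _ fun j _ => integrable_finsetSum _ fun k _ => hint j k]
  simp_rw [integral_finsetSum _ fun k _ => hint _ k, integral_const_mul]

end DampedCrossMoment

section Moments

variable {𝒳 : Type*} {f : 𝒳 → ℝ} {φ : 𝒳 → 𝒳 → ℝ} {p : ℕ} {θ : Fin p → Fin p → ℝ} {s : Fin p}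

/-- The parameter array `θ` with the entry of the ordered pair `(a, b)` shifted by `ε`. -/
def shiftPair (θ : Fin p → Fin p → ℝ) (a b : Fin p) (ε : ℝ) : Fin p → Fin p → ℝ :=
  Function.update θ a (Function.update (θ a) b (θ a b + ε))

theorem exponent_shiftPair {a b : Fin p} (hab : a < b) (ε : ℝ) (x : Fin p → 𝒳) :
    exponent f φ (shiftPair θ a b ε) x = exponent f φ θ x + ε * φ (x a) (x b) := by
  have hentry : ∀ i j, shiftPair θ a b ε i j * φ (x i) (x j) = θ i j * φ (x i) (x j)
      + if i = a then if j = b then ε * φ (x a) (x b) else 0 else 0 := fun i j => by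
    by_cases hi : i = a
    · subst hi
      by_cases hj : j = b
      · subst hj
        simp [shiftPair, add_mul]
      · simp [shiftPair, hj]
    · simp [shiftPair, hi]
  simp only [exponent, hentry, Finset.sum_add_distrib, ← add_assoc]
  congr 1
  rw [Finset.sum_eq_single a (fun i _ hi => by simp [hi]) (by simp)]
  simp [hab]

theorem exists_normalizable_shiftPair [MeasurableSpace 𝒳] {ν : Measure 𝒳}
    (hA : ∀ᶠ θ' in 𝓝 θ, Normalizable ν f φ θ') (a b : Fin p) :
    ∃ ε : ℝ, 0 < ε ∧ Normalizable ν f φ (shiftPair θ a b ε) ∧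
      Normalizable ν f φ (shiftPair θ a b (-ε)) := by
  have hcont : Continuous fun ε : ℝ => shiftPair θ a b ε :=
    continuous_const.update a (continuous_const.update b (by fun_prop))
  have htendsto : Tendsto (fun ε : ℝ => shiftPair θ a b ε) (𝓝 0) (𝓝 θ) := by
    simpa [shiftPair] using hcont.tendsto 0
  obtain ⟨δ, hδ, hball⟩ := Metric.eventually_nhds_iff.1 (htendsto.eventually hA)
  exact ⟨δ / 2, half_pos hδ, hball (by simpa [abs_of_pos hδ] using hδ),
    hball (by simpa [abs_of_pos hδ] using hδ)⟩

theorem kernel_eval_update (x : Fin p → 𝒳) (u : 𝒳) (t : {t : Fin p // t ≠ s}) :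
    φ (Function.update x s u s) (Function.update x s u t) = φ u (x t) := by
  rw [Function.update_self, Function.update_of_ne t.2]

variable [MeasurableSpace 𝒳] {ν : Measure 𝒳}

/-- The conditional score of node `s` in direction `t`, as a statistic of one observation. -/
def score (ν : Measure 𝒳) (f : 𝒳 → ℝ) (φ : 𝒳 → 𝒳 → ℝ) (θs : NodeParam s)
    (t : {t : Fin p // t ≠ s}) (x : Fin p → 𝒳) : ℝ :=
  centredFeature ν f φ θs x (x s) t

/-- The coefficients of the quadratic form `curvature ν f φ θs x`. -/
def curvatureEntry (ν : Measure 𝒳) (f : 𝒳 → ℝ) (φ : 𝒳 → 𝒳 → ℝ) (θs : NodeParam s)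
    (t t' : {t : Fin p // t ≠ s}) (x : Fin p → 𝒳) : ℝ :=
  dampedCrossMoment (condLaw ν f φ θs x) (centredFeature ν f φ θs x) t t'

namespace KernelModel

variable (M : KernelModel ν f φ)
include M

theorem condMean_apply (θs : NodeParam s) (x : Fin p → 𝒳) (t : {t : Fin p // t ≠ s}) :
    condMean ν f φ θs x t = ∫ u, φ u (x t) ∂(condLaw ν f φ θs x) :=
  ((EuclideanSpace.proj t : NodeParam s →L[ℝ] ℝ).integral_comp_comm
    (M.hasExpMoments_feature θs x).integrable).symm

theorem curvature_eq_sum [NeZero ν] (θs : NodeParam s) (x : Fin p → 𝒳) (Δ : NodeParam s) :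
    curvature ν f φ θs x Δ = ∑ t, ∑ t', Δ t * Δ t' * curvatureEntry ν f φ θs t t' x :=
  have := M.isProbabilityMeasure_condLaw θs x
  dampedSecondMoment_eq_sum (M.hasExpMoments_centredFeature θs x).aestronglyMeasurable Δ

variable [SigmaFinite ν]

theorem stronglyMeasurable_integral_condLaw {E : Type*} [NormedAddCommGroup E] [NormedSpace ℝ E]
    (θs : NodeParam s) {F : (Fin p → 𝒳) → 𝒳 → E} (hF : StronglyMeasurable (Function.uncurry F)) :
    StronglyMeasurable fun x => ∫ u, F x u ∂(condLaw ν f φ θs x) := by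
  have hexp : StronglyMeasurable fun z : (Fin p → 𝒳) × 𝒳 =>
      Real.exp (nodeExponent f φ θs z.2 z.1) :=
    (Real.measurable_exp.comp (M.measurable_nodeExponent θs)).stronglyMeasurable
  simp only [condLaw, integral_tilted]
  exact ((hexp.div (hexp.integral_prod_right'.comp_measurable measurable_fst)).smul
    hF).integral_prod_right'

theorem measurable_condMean (θs : NodeParam s) : Measurable (condMean ν f φ θs) :=
  (M.stronglyMeasurable_integral_condLaw θs
    (measurable_feature M.measurable_kernel).stronglyMeasurable).measurable

theorem measurable_centredFeature (θs : NodeParam s) :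
    Measurable fun z : (Fin p → 𝒳) × 𝒳 => centredFeature ν f φ θs z.1 z.2 :=
  (measurable_feature M.measurable_kernel).sub ((M.measurable_condMean θs).comp measurable_fst)

variable [NeZero ν] (hA : ∀ᶠ θ' in 𝓝 θ, Normalizable ν f φ θ')

section Score

include hA

theorem integrable_kernel_sq_of_lt {a b : Fin p} (hab : a < b) :
    Integrable (fun x => φ (x a) (x b) ^ 2) (jointLaw ν f φ θ) := by
  obtain ⟨ε, hε, hplus, hminus⟩ := exists_normalizable_shiftPair hA a b
  have hsq : ∀ r : ℝ, r ^ 2 ≤ 2 / ε ^ 2 * (Real.exp (ε * r) + Real.exp (-ε * r)) := fun r => by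
    have habs : (ε * r) ^ 2 / 2 ≤ Real.exp |ε * r| := by
      have := Real.quadratic_le_exp_of_nonneg (abs_nonneg (ε * r))
      rw [sq_abs] at this
      linarith [abs_nonneg (ε * r)]
    rw [div_mul_eq_mul_div, le_div_iff₀ (by positivity), neg_mul]
    linarith [Real.exp_abs_le (ε * r), mul_pow ε r 2]
  have hexponent := M.measurable_exponent θ
  have hkernel := M.measurable_kernel_eval a b
  rw [jointLaw_eq_tilted hA.self_of_nhds, integrable_tilted_iff hA.self_of_nhds]
  refine ((hplus.add hminus).const_mul (2 / ε ^ 2)).mono'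
    (hexponent.exp.mul (hkernel.pow_const 2)).aestronglyMeasurable
    (Eventually.of_forall fun x => ?_)
  simp only [Pi.add_apply, exponent_shiftPair hab, Real.exp_add, smul_eq_mul, ← mul_add]
  rw [Real.norm_of_nonneg (by positivity), mul_left_comm]
  gcongr
  exact hsq _

theorem memLp_kernel_eval {a b : Fin p} (hab : a ≠ b) :
    MemLp (fun x => φ (x a) (x b)) 2 (jointLaw ν f φ θ) := by
  rw [memLp_two_iff_integrable_sq (M.measurable_kernel_eval a b).aestronglyMeasurable]
  rcases hab.lt_or_gt with hlt | hgt
  · exact M.integrable_kernel_sq_of_lt hA hlt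
  · simp_rw [M.mercer.symm (_ : 𝒳) ((_ : Fin p → 𝒳) b)]
    exact M.integrable_kernel_sq_of_lt hA hgt

variable (hθ : ∀ s t, θ s t = θ t s)
include hθ

theorem memLp_condMean (t : {t : Fin p // t ≠ s}) :
    MemLp (fun x => condMean ν f φ (nodeParam θ s) x t) 2 (jointLaw ν f φ θ) := by
  simpa only [M.condMean_apply, kernel_eval_update] using
    M.memLp_two_integral_condLaw hθ hA.self_of_nhds s (M.memLp_kernel_eval hA t.2.symm)

theorem memLp_score (t : {t : Fin p // t ≠ s}) :
    MemLp (score ν f φ (nodeParam θ s) t) 2 (jointLaw ν f φ θ) :=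
  (M.memLp_kernel_eval hA t.2.symm).sub (M.memLp_condMean hA hθ t)

theorem integral_score (t : {t : Fin p // t ≠ s}) :
    ∫ x, score ν f φ (nodeParam θ s) t x ∂(jointLaw ν f φ θ) = 0 := by
  have := isProbabilityMeasure_jointLaw hA.self_of_nhds
  have hkernel := (M.memLp_kernel_eval hA t.2.symm).integrable one_le_two
  have htower := M.integral_integral_condLaw hθ hA.self_of_nhds s hkernel
  simp only [kernel_eval_update, ← M.condMean_apply] at htower
  calc ∫ x, score ν f φ (nodeParam θ s) t x ∂(jointLaw ν f φ θ)
      = ∫ x, φ (x s) (x t) ∂(jointLaw ν f φ θ)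
        - ∫ x, condMean ν f φ (nodeParam θ s) x t ∂(jointLaw ν f φ θ) :=
        integral_sub hkernel ((M.memLp_condMean hA hθ t).integrable one_le_two)
    _ = 0 := by rw [htower, sub_self]

end Score

variable {J : Measure (Fin p → 𝒳)} [IsFiniteMeasure J]

theorem memLp_curvatureEntry (θs : NodeParam s) (t t' : {t : Fin p // t ≠ s}) :
    MemLp (curvatureEntry ν f φ θs t t') 2 J := by
  have hcentred := M.measurable_centredFeature θs
  have hentry : StronglyMeasurable (curvatureEntry ν f φ θs t t') := by
    refine M.stronglyMeasurable_integral_condLaw θs (Measurable.stronglyMeasurable ?_)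
    simp only [Function.uncurry_def]
    fun_prop
  refine MemLp.of_bound hentry.aestronglyMeasurable 2 (Eventually.of_forall fun x => ?_)
  have := M.isProbabilityMeasure_condLaw θs x
  exact abs_dampedCrossMoment_le_two t t'

theorem integrable_curvature (θs Δ : NodeParam s) : Integrable (curvature ν f φ θs · Δ) J := by
  simp_rw [M.curvature_eq_sum θs _ Δ]
  exact integrable_finsetSum _ fun t _ => integrable_finsetSum _ fun t' _ =>
    ((M.memLp_curvatureEntry θs t t').integrable one_le_two).const_mul _

theorem integral_curvature (θs Δ : NodeParam s) :
    ∫ x, curvature ν f φ θs x Δ ∂J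
      = ∑ t, ∑ t', Δ t * Δ t' * ∫ x, curvatureEntry ν f φ θs t t' x ∂J := by
  have hint : ∀ t t', Integrable (fun x => Δ t * Δ t' * curvatureEntry ν f φ θs t t' x) J :=
    fun t t' => ((M.memLp_curvatureEntry θs t t').integrable one_le_two).const_mul _
  simp_rw [M.curvature_eq_sum θs _ Δ]
  rw [integral_finsetSum _ fun t _ => integrable_finsetSum _ fun t' _ => hint t t']
  simp_rw [integral_finsetSum _ fun t' _ => hint _ t', integral_const_mul]

end KernelModel

end Moments

section QuadraticForm

theorem exists_pos_mul_norm_sq_le {E : Type*} [NormedAddCommGroup E] [NormedSpace ℝ E]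
    [ProperSpace E] {Q : E → ℝ} (hQ : Continuous Q) (hsmul : ∀ (r : ℝ) x, Q (r • x) = r ^ 2 * Q x)
    (hpos : ∀ x, x ≠ 0 → 0 < Q x) :
    ∃ m : ℝ, 0 < m ∧ ∀ x, m * ‖x‖ ^ 2 ≤ Q x := by
  have hzero : Q 0 = 0 := by simpa using hsmul 0 0
  rcases subsingleton_or_nontrivial E with _ | _
  · exact ⟨1, one_pos, fun x => by simp [Subsingleton.elim x 0, hzero]⟩
  obtain ⟨x₀, hx₀, hmin⟩ := (isCompact_sphere (0 : E) 1).exists_isMinOn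
    (NormedSpace.sphere_nonempty.2 zero_le_one) hQ.continuousOn
  refine ⟨Q x₀, hpos x₀ (ne_zero_of_mem_unit_sphere ⟨x₀, hx₀⟩), fun x => ?_⟩
  rcases eq_or_ne x 0 with rfl | hx
  · simp [hzero]
  have hunit : ‖x‖⁻¹ • x ∈ Metric.sphere (0 : E) 1 := by
    simp [norm_smul, norm_ne_zero_iff.2 hx]
  calc Q x₀ * ‖x‖ ^ 2 ≤ Q (‖x‖⁻¹ • x) * ‖x‖ ^ 2 := by gcongr; exact hmin hunit
    _ = Q x := by rw [mul_comm, ← hsmul, smul_inv_smul₀ (norm_ne_zero_iff.2 hx)]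

theorem abs_sum_sum_mul_le {ι : Type*} [Fintype ι] {A : ι → ι → ℝ} {ε : ℝ} (hε : 0 ≤ ε)
    (hA : ∀ j k, |A j k| ≤ ε) (Δ : EuclideanSpace ℝ ι) :
    |∑ j, ∑ k, Δ j * Δ k * A j k| ≤ ε * Fintype.card ι * ‖Δ‖ ^ 2 := by
  calc |∑ j, ∑ k, Δ j * Δ k * A j k| ≤ ∑ j, ∑ k, |Δ j * Δ k * A j k| :=
        (Finset.abs_sum_le_sum_abs _ _).trans
          (Finset.sum_le_sum fun j _ => Finset.abs_sum_le_sum_abs _ _)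
    _ ≤ ∑ j, ∑ k, |Δ j| * |Δ k| * ε := by
        gcongr with j _ k _
        rw [abs_mul, abs_mul]
        gcongr
        exact hA j k
    _ = ε * (∑ j, |Δ j|) ^ 2 := by
        simp_rw [← Finset.sum_mul, ← Finset.mul_sum, ← Finset.sum_mul]
        ring
    _ ≤ ε * (Fintype.card ι * ‖Δ‖ ^ 2) := by
        gcongr
        rw [EuclideanSpace.norm_sq_eq]
        simpa using sq_sum_le_card_mul_sum_sq (s := Finset.univ) (f := fun j => |Δ j|)
    _ = _ := (mul_assoc _ _ _).symm

end QuadraticForm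

section Identifiability

variable {𝒳 : Type*} {φ : 𝒳 → 𝒳 → ℝ} {f : 𝒳 → ℝ} {p : ℕ} {θ : Fin p → Fin p → ℝ} {s : Fin p}

theorem inner_feature_update_sub (Δ : NodeParam s) (t : {t : Fin p // t ≠ s}) (x : Fin p → 𝒳)
    (y u : 𝒳) :
    ⟪Δ, feature φ s (Function.update x t y) u⟫ - ⟪Δ, feature φ s x u⟫
      = Δ t * (φ u y - φ u (x t)) := by
  rw [← inner_sub_right, PiLp.inner_apply, Finset.sum_eq_single t]
  · simp [feature, mul_comm]
  · intro t' _ hne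
    simp [feature, Function.update_of_ne (Subtype.coe_ne_coe.2 hne)]
  · simp

variable [MeasurableSpace 𝒳] {ν : Measure 𝒳}

namespace KernelModel

variable (M : KernelModel ν f φ)
include M

theorem integrable_exp_potential : Integrable (fun u => Real.exp (f u)) ν := by
  simpa using M.integrable_exp 0

theorem integrable_diag_tilted : Integrable (fun u => φ u u) (ν.tilted f) := by
  have hsqrt : Measurable fun u => √(φ u u) :=
    (M.measurable_kernel.comp (measurable_id.prodMk measurable_id)).sqrt
  have hexp : HasExpMoments (ν.tilted f) fun u => √(φ u u) :=
    { aestronglyMeasurable := hsqrt.aestronglyMeasurable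
      integrable_exp_mul_norm := fun a => by
        rw [integrable_tilted_iff M.integrable_exp_potential]
        simpa [Real.exp_add, abs_of_nonneg (Real.sqrt_nonneg _)] using M.integrable_exp a }
  refine hexp.integrable_norm_sq_mul_exp.mono'
    (M.measurable_kernel.comp (measurable_id.prodMk measurable_id)).aestronglyMeasurable
    (Eventually.of_forall fun u => ?_)
  simp only [Real.norm_eq_abs, sq_abs, Real.sq_sqrt (M.mercer.diag_nonneg u)]
  rw [abs_of_nonneg (M.mercer.diag_nonneg u)]
  exact le_mul_of_one_le_right (M.mercer.diag_nonneg u) (Real.one_le_exp (abs_nonneg _))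

variable [SigmaFinite ν] [NeZero ν]

theorem ae_ae_inner_feature_eq_of_integral_curvature_eq_zero {J : Measure (Fin p → 𝒳)}
    [IsFiniteMeasure J] {θs Δ : NodeParam s} (h : ∫ x, curvature ν f φ θs x Δ ∂J = 0) :
    ∀ᵐ x ∂J, ∀ᵐ u ∂ν, ⟪Δ, feature φ s x u⟫ = ⟪Δ, condMean ν f φ θs x⟫ := by
  filter_upwards [(integral_eq_zero_iff_of_nonneg (fun _ => dampedSecondMoment_nonneg)
    (M.integrable_curvature θs Δ)).1 h] with x hx
  have := M.isProbabilityMeasure_condLaw θs x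
  filter_upwards [(absolutelyContinuous_tilted (M.integrable_exp_nodeExponent θs x)).ae_le
    (ae_inner_eq_zero_of_dampedSecondMoment_eq_zero
      (M.hasExpMoments_centredFeature θs x).aestronglyMeasurable hx)] with u hu
  rwa [centredFeature, inner_sub_right, sub_eq_zero] at hu

theorem exists_ae_eq_const_of_ae_ae_eq_add {a d : 𝒳 → ℝ} (ha : Measurable a) (hd : Measurable d)
    (hsplit : ∀ᵐ x ∂ν, ∀ᵐ y ∂ν, φ x y = a x + d y) :
    ∃ H, ∀ᵐ z ∂(ν.prod ν), φ z.1 z.2 = H := by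
  have := isProbabilityMeasure_tilted M.integrable_exp_potential
  have hprod : ∀ᵐ z ∂(ν.prod ν), φ z.1 z.2 = a z.1 + d z.2 :=
    (Measure.ae_prod_iff_ae_ae (measurableSet_eq_fun M.measurable_kernel (by fun_prop))).2 hsplit
  have hac : ν.tilted f ≪ ν := tilted_absolutelyContinuous ν f
  have hac' : ν ≪ ν.tilted f := absolutelyContinuous_tilted M.integrable_exp_potential
  obtain ⟨H, hH⟩ := M.mercer.exists_ae_eq_const_of_ae_eq_add M.measurable_kernel
    M.integrable_diag_tilted ((hac.prod hac).ae_le hprod)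
  exact ⟨H, (hac'.prod hac').ae_le hH⟩

variable (hN : Normalizable ν f φ θ) (hθ : ∀ s t, θ s t = θ t s)
include hN

omit M in
theorem jointLaw_shiftPair_of_ae_eq_const {a b : Fin p} (hab : a < b) {H : ℝ}
    (hH : ∀ᵐ x ∂(Measure.pi fun _ : Fin p => ν), φ (x a) (x b) = H) (ε : ℝ) :
    Normalizable ν f φ (shiftPair θ a b ε) ∧
      jointLaw ν f φ (shiftPair θ a b ε) = jointLaw ν f φ θ := by
  have hshift : exponent f φ (shiftPair θ a b ε) =ᵐ[Measure.pi fun _ => ν]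
      fun x => exponent f φ θ x + ε * H := by
    filter_upwards [hH] with x hx
    rw [exponent_shiftPair hab, hx]
  have hN' : Normalizable ν f φ (shiftPair θ a b ε) := by
    refine (hN.mul_const (Real.exp (ε * H))).congr ?_
    filter_upwards [hshift] with x hx
    rw [hx, Real.exp_add]
  refine ⟨hN', ?_⟩
  rw [jointLaw_eq_tilted hN', jointLaw_eq_tilted hN, tilted_congr hshift, tilted_add_const]

include hθ

theorem ae_pi_kernel_eq_const {a b : Fin p} (hab : a ≠ b) {H : ℝ}
    (hH : ∀ᵐ z ∂(ν.prod ν), φ z.1 z.2 = H) :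
    ∀ᵐ x ∂(Measure.pi fun _ : Fin p => ν), φ (x a) (x b) = H := by
  have hsection : MeasurableSet {y : 𝒳 | ∀ᵐ u ∂ν, φ y u = H} :=
    measurable_measure_prodMk_left (measurableSet_eq_fun M.measurable_kernel
      (measurable_const (a := H))).compl (measurableSet_singleton 0)
  have hfst : ∀ᵐ x ∂(jointLaw ν f φ θ), ∀ᵐ u ∂ν, φ (x a) u = H := by
    refine M.ae_jointLaw_of_ae_ae_update hθ hN a (hsection.preimage (measurable_pi_apply a))
      (Eventually.of_forall fun x => ?_)
    simpa only [Function.update_self] using Measure.ae_ae_of_ae_prod hH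
  have hboth : ∀ᵐ x ∂(jointLaw ν f φ θ), φ (x a) (x b) = H := by
    refine M.ae_jointLaw_of_ae_ae_update hθ hN b
      (measurableSet_eq_fun (M.measurable_kernel_eval a b) measurable_const) ?_
    simpa only [Function.update_self, Function.update_of_ne hab] using hfst
  rw [jointLaw_eq_tilted hN] at hboth
  exact (absolutelyContinuous_tilted hN).ae_le hboth

variable (hmin : HasMinimalRepresentation ν f φ θ)
include hmin

theorem not_ae_eq_const {a b : Fin p} (hab : a ≠ b) (H : ℝ) :
    ¬ ∀ᵐ z ∂(ν.prod ν), φ z.1 z.2 = H := by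
  wlog hlt : a < b generalizing a b
  · exact this hab.symm (hab.lt_or_gt.resolve_left hlt)
  intro hH
  obtain ⟨hN', hlaw⟩ := jointLaw_shiftPair_of_ae_eq_const hN hlt
    (M.ae_pi_kernel_eq_const hN hθ hab hH) 1
  simpa [shiftPair] using hmin _ hN' hlaw a b hlt

/-- If the curvature vanished at `Δ ≠ 0`, moving a coordinate `t` with `Δ t ≠ 0` would split `φ`
into a sum of functions of one variable, which for a Mercer kernel forces it to be constant. -/
theorem integral_curvature_pos {Δ : NodeParam s} (hΔ : Δ ≠ 0) :
    0 < ∫ x, curvature ν f φ (nodeParam θ s) x Δ ∂(jointLaw ν f φ θ) := by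
  have := isProbabilityMeasure_jointLaw hN
  refine (integral_nonneg fun x => dampedSecondMoment_nonneg).lt_of_ne' fun hzero => ?_
  set c := fun x => ⟪Δ, condMean ν f φ (nodeParam θ s) x⟫
  have hc : Measurable c := (M.measurable_condMean _).const_inner
  have hinner := M.ae_ae_inner_feature_eq_of_integral_curvature_eq_zero hzero
  obtain ⟨t, ht⟩ : ∃ t, Δ t ≠ 0 := by
    by_contra! h
    exact hΔ (PiLp.ext h)
  obtain ⟨x, hx, hupdate⟩ :=
    (hinner.and (M.ae_ae_update_of_ae_jointLaw hθ hN t hinner)).exists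
  have hsplit : ∀ᵐ y ∂ν, ∀ᵐ u ∂ν,
      φ y u = (c (Function.update x t y) - c x) / Δ t + φ u (x t) := by
    filter_upwards [hupdate] with y hy
    filter_upwards [hx, hy] with u hu hyu
    have hdiff := inner_feature_update_sub (φ := φ) Δ t x y u
    rw [hu, hyu] at hdiff
    rw [M.mercer.symm y u, hdiff, mul_div_cancel_left₀ _ ht, sub_add_cancel]
  obtain ⟨H, hH⟩ := M.exists_ae_eq_const_of_ae_ae_eq_add
    (((hc.comp (measurable_update x)).sub_const _).div_const _)
    (M.measurable_kernel.comp measurable_prodMk_right) hsplit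
  exact M.not_ae_eq_const hN hθ hmin t.2 H hH

end KernelModel

end Identifiability

section ErrorBound

variable {𝒳 : Type*} [MeasurableSpace 𝒳] {ν : Measure 𝒳} {f : 𝒳 → ℝ} {φ : 𝒳 → 𝒳 → ℝ} {p n : ℕ}
  {θ : Fin p → Fin p → ℝ} {s : Fin p}

/-- The event that, for every regularization level between `2` and `c₀` times the maximum norm of
the gradient of the loss at `θs`, the lasso estimators of `θs` exist and have error at most `r`. -/
def LassoErrorBound (ν : Measure 𝒳) (f : 𝒳 → ℝ) (φ : 𝒳 → 𝒳 → ℝ) (X : Fin n → Fin p → 𝒳)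
    (θs : NodeParam s) (c₀ r : ℝ) : Prop :=
  ∀ lam : ℝ, 2 * nodeGradSup ν f φ X θs ≤ lam → lam ≤ c₀ * nodeGradSup ν f φ X θs →
    (nodeEstimators ν f φ s X lam).Nonempty ∧
      ∀ θhat ∈ nodeEstimators ν f φ s X lam, ‖θhat - θs‖ ≤ r

theorem LassoErrorBound.mono {X : Fin n → Fin p → 𝒳} {θs : NodeParam s} {c₀ r r' : ℝ}
    (h : LassoErrorBound ν f φ X θs c₀ r) (hr : r ≤ r') : LassoErrorBound ν f φ X θs c₀ r' :=
  fun lam hlower hupper => ⟨(h lam hlower hupper).1,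
    fun θhat hθhat => ((h lam hlower hupper).2 θhat hθhat).trans hr⟩

theorem nodeGrad_apply (X : Fin n → Fin p → 𝒳) (θs : NodeParam s) (t : {t : Fin p // t ≠ s}) :
    nodeGrad ν f φ X θs t = -sampleMean (score ν f φ θs t) X := by
  simp [nodeGrad, sampleMean, score]

namespace KernelModel

variable (M : KernelModel ν f φ) [NeZero ν]
include M

theorem lassoErrorBound (X : Fin n → Fin p → 𝒳) (θs : NodeParam s) {m a c₀ : ℝ}
    (hcurv : ∀ Δ, m * ‖Δ‖ ^ 2 ≤ 1 / (n : ℝ) * ∑ i, curvature ν f φ θs (X i) Δ)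
    (hscore : ∀ t, |sampleMean (score ν f φ θs t) X| ≤ a) (ha : 0 ≤ a) (hc₀ : 0 ≤ c₀)
    (hsmall : 12 * (c₀ * a) * √(l0Norm θs : ℝ) < m) :
    LassoErrorBound ν f φ X θs c₀ (12 * (c₀ * a) * √(l0Norm θs : ℝ) / m) := by
  intro lam hlower hupper
  have hm : 0 ≤ m := le_trans (by positivity) hsmall.le
  have hgrad : nodeGradSup ν f φ X θs ≤ a := by
    rw [M.nodeGradSup_eq]
    exact Real.iSup_le (fun t => by rw [nodeGrad_apply, abs_neg]; exact hscore t) ha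
  have hlam : 12 * lam * √(l0Norm θs : ℝ) ≤ 12 * (c₀ * a) * √(l0Norm θs : ℝ) := by
    gcongr
    exact hupper.trans (mul_le_mul_of_nonneg_left hgrad hc₀)
  obtain ⟨hexists, herror⟩ := M.nodeEstimators_error X θs hcurv hlower (hlam.trans_lt hsmall)
  exact ⟨hexists, fun θhat hθhat => (herror θhat hθhat).trans (by gcongr)⟩

theorem mean_curvature_eq_sum (X : Fin n → Fin p → 𝒳) (θs Δ : NodeParam s) :
    1 / (n : ℝ) * ∑ i, curvature ν f φ θs (X i) Δ
      = ∑ t, ∑ t', Δ t * Δ t' * sampleMean (curvatureEntry ν f φ θs t t') X := by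
  simp_rw [M.curvature_eq_sum, sampleMean, mul_left_comm _ (1 / (n : ℝ)), ← Finset.mul_sum]
  congr 1
  rw [Finset.sum_comm]
  refine Finset.sum_congr rfl fun t _ => ?_
  rw [Finset.sum_comm]
  simp_rw [Finset.mul_sum]

variable [SigmaFinite ν]

theorem mul_norm_sq_le_mean_curvature {J : Measure (Fin p → 𝒳)} [IsFiniteMeasure J]
    {X : Fin n → Fin p → 𝒳} {θs : NodeParam s} {m ε : ℝ} (hε : 0 ≤ ε)
    (hm : ∀ Δ : NodeParam s, m * ‖Δ‖ ^ 2 ≤ ∫ x, curvature ν f φ θs x Δ ∂J)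
    (hX : ∀ t t', |sampleMean (curvatureEntry ν f φ θs t t') X
      - ∫ x, curvatureEntry ν f φ θs t t' x ∂J| ≤ ε) (Δ : NodeParam s) :
    (m - ε * Fintype.card {t : Fin p // t ≠ s}) * ‖Δ‖ ^ 2
      ≤ 1 / (n : ℝ) * ∑ i, curvature ν f φ θs (X i) Δ := by
  have hdev := abs_sum_sum_mul_le hε hX Δ
  simp_rw [mul_sub, Finset.sum_sub_distrib] at hdev
  rw [← M.mean_curvature_eq_sum, ← M.integral_curvature] at hdev
  linarith [hm Δ, neg_le_of_abs_le hdev]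

variable (hA : ∀ᶠ θ' in 𝓝 θ, Normalizable ν f φ θ') (hθ : ∀ s t, θ s t = θ t s)
include hA hθ

theorem measure_not_lassoErrorBound_le {m ε a c₀ : ℝ} (hn : n ≠ 0) (ha : 0 < a) (hε : 0 < ε)
    (hc₀ : 0 ≤ c₀)
    (hm : ∀ Δ, m * ‖Δ‖ ^ 2 ≤ ∫ x, curvature ν f φ (nodeParam θ s) x Δ ∂(jointLaw ν f φ θ))
    (hsmall : 12 * (c₀ * a) * √(l0Norm (nodeParam θ s) : ℝ)
      < m - ε * Fintype.card {t : Fin p // t ≠ s}) :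
    (Measure.pi fun _ : Fin n => jointLaw ν f φ θ)
        {X | ¬ LassoErrorBound ν f φ X (nodeParam θ s) c₀
          (12 * (c₀ * a) * √(l0Norm (nodeParam θ s) : ℝ)
            / (m - ε * Fintype.card {t : Fin p // t ≠ s}))}
      ≤ ENNReal.ofReal
          ((∑ t, variance (score ν f φ (nodeParam θ s) t) (jointLaw ν f φ θ)) / (n * a ^ 2))
        + ENNReal.ofReal ((∑ q : {t : Fin p // t ≠ s} × {t : Fin p // t ≠ s},
          variance (curvatureEntry ν f φ (nodeParam θ s) q.1 q.2) (jointLaw ν f φ θ))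
            / (n * ε ^ 2)) := by
  have := isProbabilityMeasure_jointLaw hA.self_of_nhds
  refine (measure_mono fun X hX => ?_).trans ((measure_union_le _ _).trans (add_le_add
    (measure_exists_sampleMean_deviation_le (M.memLp_score hA hθ) hn ha)
    (measure_exists_sampleMean_deviation_le (fun q : {t : Fin p // t ≠ s} × {t : Fin p // t ≠ s} =>
      M.memLp_curvatureEntry (nodeParam θ s) q.1 q.2) hn hε)))
  contrapose! hX
  simp only [Set.mem_union, Set.mem_ofPred_eq, not_or, not_exists, not_le, Prod.forall,
    M.integral_score hA hθ, sub_zero] at hX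
  obtain ⟨hscore, hcurv⟩ := hX
  exact not_not.2 (M.lassoErrorBound X (nodeParam θ s)
    (M.mul_norm_sq_le_mean_curvature hε.le hm fun t t' => (hcurv t t').le)
    (fun t => (hscore t).le) ha.le hc₀ hsmall)

end KernelModel

end ErrorBound

section Asymptotics

variable {𝒳 : Type*} [MeasurableSpace 𝒳] {ν : Measure 𝒳} {f : 𝒳 → ℝ} {φ : 𝒳 → 𝒳 → ℝ} {p : ℕ}
  {θ : Fin p → Fin p → ℝ} {s : Fin p}

theorem pi_const_zero {ι : Type*} [Fintype ι] [Nonempty ι] :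
    Measure.pi (fun _ : ι => (0 : Measure 𝒳)) = 0 :=
  Measure.measure_univ_eq_zero.1 (by simp [Measure.pi_univ])

theorem jointLaw_zero [NeZero p] (f : 𝒳 → ℝ) (φ : 𝒳 → 𝒳 → ℝ) (θ : Fin p → Fin p → ℝ) :
    jointLaw (0 : Measure 𝒳) f φ θ = 0 := by
  rw [jointLaw, pi_const_zero, withDensity_zero_left]

namespace KernelModel

theorem of_neg_diag (hm : Measurable (Function.uncurry φ)) (hφ : IsMercerKernel φ)
    (hint : ∀ c : ℝ, 0 < c → Integrable (fun x => Real.exp (-c * φ x x)) ν)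
    (hf : ∀ x, f x = -φ x x) : KernelModel ν f φ where
  measurable_kernel := hm
  measurable_potential := by
    simp_rw [funext hf]
    exact (hm.comp (measurable_id.prodMk measurable_id)).neg
  mercer := hφ
  integrable_exp a := by
    have : Measurable fun u => φ u u := hm.comp (measurable_id.prodMk measurable_id)
    simp_rw [hf]
    refine ((hint (1 / 2) one_half_pos).const_mul (Real.exp (a ^ 2 / 2))).mono' (by fun_prop)
      (Eventually.of_forall fun u => ?_)
    rw [Real.norm_eq_abs, Real.abs_exp, ← Real.exp_add, Real.exp_le_exp]
    nlinarith [sq_nonneg (a - √(φ u u)), Real.sq_sqrt (hφ.diag_nonneg u)]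

variable (M : KernelModel ν f φ) [SigmaFinite ν] [NeZero ν]
  (hA : ∀ᶠ θ' in 𝓝 θ, Normalizable ν f φ θ') (hθ : ∀ s t, θ s t = θ t s)
  (hmin : HasMinimalRepresentation ν f φ θ)
include M hA hθ hmin

theorem exists_mul_norm_sq_le_integral_curvature (s : Fin p) :
    ∃ m : ℝ, 0 < m ∧
      ∀ Δ, m * ‖Δ‖ ^ 2 ≤ ∫ x, curvature ν f φ (nodeParam θ s) x Δ ∂(jointLaw ν f φ θ) := by
  have hN := hA.self_of_nhds
  have := isProbabilityMeasure_jointLaw hN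
  refine exists_pos_mul_norm_sq_le ?_ (fun r Δ => ?_)
    fun Δ hΔ => M.integral_curvature_pos hN hθ hmin hΔ
  · simp_rw [M.integral_curvature]
    fun_prop
  · rw [← integral_const_mul]
    simp only [curvature, dampedSecondMoment_smul]

theorem exists_measure_not_lassoErrorBound_le (s : Fin p) {δ : ℝ} (hδ : 0 < δ) :
    ∃ K : ℝ, 0 < K ∧ ∀ c₀ : ℝ, 0 ≤ c₀ → ∃ N : ℕ, ∀ n : ℕ, N ≤ n →
      (Measure.pi fun _ : Fin n => jointLaw ν f φ θ)
        {X | ¬ LassoErrorBound ν f φ X (nodeParam θ s) c₀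
          (K * c₀ * √((l0Norm (nodeParam θ s) : ℝ) / n))} ≤ ENNReal.ofReal δ := by
  obtain ⟨m, hm, hcurv⟩ := M.exists_mul_norm_sq_le_integral_curvature hA hθ hmin s
  set d : ℝ := (Fintype.card {t : Fin p // t ≠ s} : ℝ)
  set k : ℝ := (l0Norm (nodeParam θ s) : ℝ)
  set V := ∑ t, variance (score ν f φ (nodeParam θ s) t) (jointLaw ν f φ θ)
  set W := ∑ q : {t : Fin p // t ≠ s} × {t : Fin p // t ≠ s},
    variance (curvatureEntry ν f φ (nodeParam θ s) q.1 q.2) (jointLaw ν f φ θ)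
  obtain ⟨ε, hε, hεm⟩ := exists_pos_mul_lt hm d
  obtain ⟨b, hb, hbV⟩ := exists_pos_mul_lt (half_pos hδ) V
  rw [← sub_pos, mul_comm] at hεm
  refine ⟨12 * (√b)⁻¹ / (m - ε * d), by positivity, fun c₀ hc₀ => ?_⟩
  have hsmall : ∀ᶠ n : ℕ in atTop, 12 * (c₀ * √(1 / (b * n))) * √k < m - ε * d := by
    have hlim := (((tendsto_const_div_atTop_nhds_zero_nat (1 / b)).sqrt.const_mul c₀).const_mul
      12).mul_const √k
    simp only [Real.sqrt_zero, mul_zero, zero_mul, div_div] at hlim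
    exact hlim.eventually_lt_const hεm
  have hcurv_dev : ∀ᶠ n : ℕ in atTop, W / (n * ε ^ 2) < δ / 2 := by
    have hlim := tendsto_const_div_atTop_nhds_zero_nat (W / ε ^ 2)
    simp only [div_div, mul_comm (ε ^ 2)] at hlim
    exact hlim.eventually_lt_const (half_pos hδ)
  obtain ⟨N, hlarge⟩ := eventually_atTop.1 (hsmall.and (hcurv_dev.and (eventually_gt_atTop 0)))
  refine ⟨N, fun n hn => ?_⟩
  obtain ⟨hsmall_n, hcurv_n, hn_pos⟩ := hlarge n hn
  have : (0 : ℝ) < n := Nat.cast_pos.2 hn_pos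
  have hscore_dev : V / (n * √(1 / (b * n)) ^ 2) = V * b := by
    rw [Real.sq_sqrt (by positivity)]
    field_simp
  have hradius : 12 * (√b)⁻¹ / (m - ε * d) * c₀ * √(k / n)
      = 12 * (c₀ * √(1 / (b * n))) * √k / (m - ε * d) := by
    rw [one_div, Real.sqrt_inv, Real.sqrt_mul hb.le, Real.sqrt_div (Nat.cast_nonneg _)]
    ring
  rw [hradius, ← add_halves δ, ENNReal.ofReal_add (by positivity) (by positivity)]
  exact (M.measure_not_lassoErrorBound_le hA hθ hn_pos.ne' (by positivity) hε hc₀ hcurv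
    hsmall_n).trans (add_le_add (ENNReal.ofReal_le_ofReal (hscore_dev.trans_lt hbV).le)
      (ENNReal.ofReal_le_ofReal hcurv_n.le))

end KernelModel

theorem exists_pos_l0Norm_le_mul_log (θs : NodeParam s) :
    ∃ b : ℝ, 0 < b ∧ (l0Norm θs : ℝ) ≤ b ^ 2 * (l0Norm θs * Real.log p) := by
  rcases (Nat.succ_le_of_lt s.pos).eq_or_lt with rfl | hp
  · have : IsEmpty {t : Fin 1 // t ≠ s} := ⟨fun t => t.2 (Subsingleton.elim _ _)⟩
    exact ⟨1, one_pos, by simp [l0Norm, Set.eq_empty_of_isEmpty {t | θs t ≠ 0}]⟩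
  · have hlog : 0 < Real.log p := Real.log_pos (Nat.one_lt_cast.2 hp)
    refine ⟨√(1 / Real.log p), by positivity, le_of_eq ?_⟩
    rw [Real.sq_sqrt (by positivity)]
    field_simp

end Asymptotics

end SemiEFGM

end

theorem corollary2_general {𝒳 : Type*} [MeasurableSpace 𝒳] {ν : Measure 𝒳} [SigmaFinite ν]
    {f : 𝒳 → ℝ} {φ : 𝒳 → 𝒳 → ℝ} (M : SemiEFGM.KernelModel ν f φ)
    {p : ℕ} {θ : Fin p → Fin p → ℝ} (hθ_symm : ∀ s t, θ s t = θ t s)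
    (hA : ∀ᶠ θ' in 𝓝 θ, SemiEFGM.Normalizable ν f φ θ')
    (hmin : SemiEFGM.HasMinimalRepresentation ν f φ θ)
    (s : Fin p) {δ : ℝ} (hδ : 0 < δ) :
    ∃ C : ℝ, 0 < C ∧ ∀ c₀ : ℝ, 2 ≤ c₀ → ∃ N : ℕ, ∀ n : ℕ, N ≤ n →
      (Measure.pi fun _ : Fin n => SemiEFGM.jointLaw ν f φ θ)
        {X | ¬ SemiEFGM.LassoErrorBound ν f φ X (SemiEFGM.nodeParam θ s) c₀
          (C * c₀ * √((SemiEFGM.l0Norm (SemiEFGM.nodeParam θ s) : ℝ) * Real.log p / n))}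
      ≤ ENNReal.ofReal δ := by
  rcases eq_zero_or_neZero ν with rfl | _
  · have : NeZero p := ⟨s.pos.ne'⟩
    refine ⟨1, one_pos, fun c₀ _ => ⟨1, fun n hn => ?_⟩⟩
    have : Nonempty (Fin n) := ⟨⟨0, hn⟩⟩
    simp only [SemiEFGM.jointLaw_zero, SemiEFGM.pi_const_zero, Measure.coe_zero, Pi.zero_apply,
      zero_le]
  · obtain ⟨K, hK, hbound⟩ := M.exists_measure_not_lassoErrorBound_le hA hθ_symm hmin s hδ
    obtain ⟨b, hb, hlog⟩ := SemiEFGM.exists_pos_l0Norm_le_mul_log (SemiEFGM.nodeParam θ s)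
    refine ⟨K * b, by positivity, fun c₀ hc₀ => ?_⟩
    obtain ⟨N, hN⟩ := hbound c₀ (by linarith)
    refine ⟨N, fun n hn => (measure_mono fun X => mt fun h => h.mono ?_).trans (hN n hn)⟩
    calc K * c₀ * √((SemiEFGM.l0Norm (SemiEFGM.nodeParam θ s) : ℝ) / n)
        ≤ K * c₀ * √(b ^ 2 * (SemiEFGM.l0Norm (SemiEFGM.nodeParam θ s) * Real.log p) / n) := by
          gcongr
      _ = K * b * c₀ * √((SemiEFGM.l0Norm (SemiEFGM.nodeParam θ s) : ℝ) * Real.log p / n) := by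
          rw [mul_div_assoc, Real.sqrt_mul (sq_nonneg b), Real.sqrt_sq hb.le]
          ring

theorem corollary2 {𝒳 : Type*} [MeasurableSpace 𝒳] (ν : Measure 𝒳) [SigmaFinite ν]
    (φ : 𝒳 → 𝒳 → ℝ) (hφ_meas : Measurable (Function.uncurry φ))
    (hφ : SemiEFGM.IsMercerKernel φ)
    (hφ_int : ∀ c : ℝ, 0 < c → Integrable (fun x => Real.exp (-c * φ x x)) ν)
    (f : 𝒳 → ℝ) (hf : ∀ x, f x = -φ x x)
    {p : ℕ} (θ : Fin p → Fin p → ℝ) (hθ_symm : ∀ s t, θ s t = θ t s)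
    (hA : ∀ᶠ θ' in 𝓝 θ, SemiEFGM.Normalizable ν f φ θ')
    (hmin : SemiEFGM.HasMinimalRepresentation ν f φ θ)
    (hθ_small : ∀ s t, s ≠ t → |θ s t| < 0.25)
    (s : Fin p) (κ : ℝ) (hκ : 0 < κ) :
    ∃ C : ℝ, 0 < C ∧ ∀ c₀ : ℝ, 2 ≤ c₀ → ∃ N : ℕ, ∀ n : ℕ, N ≤ n →
      (Measure.pi fun _ : Fin n => SemiEFGM.jointLaw ν f φ θ)
        {X | ¬ ∀ lam : ℝ,
          2 * SemiEFGM.nodeGradSup ν f φ X (SemiEFGM.nodeParam θ s) ≤ lam →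
          lam ≤ c₀ * SemiEFGM.nodeGradSup ν f φ X (SemiEFGM.nodeParam θ s) →
          (SemiEFGM.nodeEstimators ν f φ s X lam).Nonempty ∧
          ∀ θhat ∈ SemiEFGM.nodeEstimators ν f φ s X lam,
            ‖θhat - SemiEFGM.nodeParam θ s‖ ≤
              C * c₀ * Real.sqrt
                ((SemiEFGM.l0Norm (SemiEFGM.nodeParam θ s) : ℝ) * Real.log p / n)}
      ≤ ENNReal.ofReal ((p : ℝ) ^ (-κ)) := by
  exact corollary2_general (SemiEFGM.KernelModel.of_neg_diag hφ_meas hφ hφ_int hf) hθ_symm hA hmin s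
    (Real.rpow_pos_of_pos (Nat.cast_pos.2 s.pos) _)
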